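/- Let $\mathbb{T}=\{z\in\mathbb{C}:|z|=1\}$ and let $\mathbb{T}^\infty$ be the countably infinite product of $\mathbb{T}$, equipped with the product $\mu_\infty$ of the normalized arc length measures. For a multi-index $\alpha\in\mathbb{Z}^{\mathbb{N}}$ with finitely many non-zero components put $z^\alpha=\prod_j z_j^{\alpha_j}$, and let $c_\alpha=\int_{\mathbb{T}^\infty} f(z)\,\overline{z^\alpha}\,d\mu_\infty(z)$ be the Fourier coefficients of $f$. The Riesz projection $P$ maps $f\sim\sum_{\alpha} c_\alpha z^\alpha$ to $Pf\sim\sum_{\alpha\ge 0} c_\alpha z^\alpha$, the sum over those $\alpha$ all of whose components are non-negative. Theorem. There is a largest exponent $p_\infty\in[1,\infty]$ for which $P$ is bounded from $L^\infty(\mathbb{T}^\infty)$ to $L^{p_\infty}(\mathbb{T}^\infty)$. The equation $$\Gamma\left(1+\frac p2\right)^{1/p}=\frac{2}{\sqrt{\pi}}$$ has exactly one positive solution $p$; it satisfies $p\approx 3.31138$ (rounded to five decimals, i.e. $|p-3.31138|\le 5\cdot 10^{-6}$), and $$p_\infty\le p.$$ -/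

import Mathlib

open MeasureTheory
open scoped ENNReal NNReal

namespace PolytorusRiesz

/-- The circle `𝕋 = {z ∈ ℂ : |z| = 1}` carries its Borel σ-algebra. -/
noncomputable instance instMeasurableSpaceCircle : MeasurableSpace Circle := borel Circle

instance instBorelSpaceCircle : BorelSpace Circle := ⟨rfl⟩

/-- The Haar probability measure on the circle, i.e. the normalized arc length measure. -/
noncomputable def circleMeasure : Measure Circle := Measure.haarMeasure ⊤

instance instIsProbabilityMeasureCircle : IsProbabilityMeasure circleMeasure :=
  ⟨by
    have h := Measure.haarMeasure_self (K₀ := (⊤ : TopologicalSpace.PositiveCompacts Circle))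
    simpa [circleMeasure] using h⟩

/-- The countably infinite polytorus `𝕋^∞`, with the product σ-algebra. -/
abbrev Polytorus : Type := ℕ → Circle

/-- The measure `μ_∞` on `𝕋^∞`: the infinite product of the normalized arc length measures. -/
noncomputable def torusMeasure : Measure Polytorus :=
  Measure.infinitePi (fun _ : ℕ => circleMeasure)

/-- The monomial `z^α = ∏ j, z_j ^ α_j`, for a multi-index `α` of integers with only finitely many
non-zero components. -/
noncomputable def monomial (α : ℕ →₀ ℤ) (z : Polytorus) : ℂ :=
  α.prod fun j n => (z j : ℂ) ^ n

/-- The Fourier coefficient `c_α = ∫ f(z) conj(z^α) dμ_∞(z)`. -/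
noncomputable def coeff (f : Polytorus → ℂ) (α : ℕ →₀ ℤ) : ℂ :=
  ∫ z, f z * (starRingEnd ℂ) (monomial α z) ∂torusMeasure

open scoped Classical in
/-- `g` is the Riesz projection `Pf` of `f`: the Fourier series of `g` is
`∑ c_α z^α` over the multi-indices `α` with all components non-negative, where `c_α` are the Fourier
coefficients of `f`. (An integrable function on `𝕋^∞` is determined almost everywhere by its Fourier
coefficients.) -/
def IsRieszProjection (f g : Polytorus → ℂ) : Prop :=
  Integrable g torusMeasure ∧
    ∀ α : ℕ →₀ ℤ, coeff g α = if ∀ j, 0 ≤ α j then coeff f α else 0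

/-- The Riesz projection is bounded from `L^q(𝕋^∞)` to `L^p(𝕋^∞)`. -/
def RieszBounded (q p : ℝ≥0∞) : Prop :=
  ∃ C : ℝ≥0, ∀ f : Polytorus → ℂ, MemLp f q torusMeasure →
    ∃ g : Polytorus → ℂ, IsRieszProjection f g ∧ MemLp g p torusMeasure ∧
      eLpNorm g p torusMeasure ≤ C * eLpNorm f q torusMeasure

/-- The exponents `1 ≤ p ≤ ∞` for which the Riesz projection is bounded from `L^∞(𝕋^∞)` to
`L^p(𝕋^∞)`. -/
def boundedExponents : Set ℝ≥0∞ := {p | 1 ≤ p ∧ RieszBounded ∞ p}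

/-- The critical exponent `p_∞`. -/
noncomputable def criticalExponent : ℝ≥0∞ := sSup boundedExponents

end PolytorusRiesz

namespace PolytorusRiesz

/-! On infinitely many variables, boundedness of `P` from `L^∞` to `L^p` with `p` finite forces
contractivity. Splitting the coordinates by parity identifies `𝕋^∞` with `𝕋^∞ × 𝕋^∞`, and `P`
respects products of functions in separate variables. Such a product of `f` with itself has sup norm
at most `‖f‖²`, while that of `Pf` has `L^p` norm exactly `‖Pf‖²`. Iteration gives `‖Pf‖^(2^k) ≤ C
‖f‖^(2^k)` for all `k`, so `C` may be replaced by `1` (`RieszBounded.eLpNorm_le`). Since the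
constant does not degenerate as `p` increases, Fatou's lemma shows that a finite supremum of
admissible exponents is itself admissible; the projection itself exists because `L^∞ ⊆ L²`.

For the upper bound, test contractivity on `f = S / |S|` with `S = (z_1 + ⋯ + z_n) / √n`.
Homogeneity and permutation symmetry give `Pf = E|S| · S`, hence `‖S‖_1 ‖S‖_p ≤ 1` for every `n`. By
the central limit theorem `S` tends to a standard complex Gaussian, whose `q`-th absolute moment is
`Γ(1 + q/2)`; therefore `Γ(3/2) Γ(1 + p/2)^(1/p) ≤ 1`, where `Γ(3/2) = √π / 2`.

With `y = p/2` this reads `log Γ(1 + y) ≤ y log(4/π)`. Convexity of `log Γ` and `Γ(1) = Γ(2) = 1`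
show that equality holds for at most one `y > 0` and that the inequality fails beyond it. Two-sided
bounds for `log Γ`, from monotone sequences converging to it, locate the crossing. -/

instance instIsHaarMeasureCircle : circleMeasure.IsHaarMeasure := by
  unfold circleMeasure; infer_instance

instance instIsProbabilityMeasureTorus : IsProbabilityMeasure torusMeasure := by
  unfold torusMeasure; infer_instance

/-! ### Monomials -/

lemma continuous_monomial (α : ℕ →₀ ℤ) : Continuous (monomial α) := by
  unfold monomial Finsupp.prod
  refine continuous_finsetProd _ fun j _ => ?_
  exact (by fun_prop : Continuous fun z : Polytorus => (z j : ℂ)).zpow₀ (α j)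
    fun z => Or.inl (Circle.coe_ne_zero _)

lemma measurable_monomial (α : ℕ →₀ ℤ) : Measurable (monomial α) :=
  (continuous_monomial α).measurable

lemma norm_monomial (α : ℕ →₀ ℤ) (z : Polytorus) : ‖monomial α z‖ = 1 := by
  simp only [monomial, Finsupp.prod, norm_prod, norm_zpow, Circle.norm_coe, one_zpow,
    Finset.prod_const_one]

lemma monomial_zero (z : Polytorus) : monomial 0 z = 1 := by
  simp [monomial]

lemma monomial_add (α β : ℕ →₀ ℤ) (z : Polytorus) :
    monomial (α + β) z = monomial α z * monomial β z := by
  unfold monomial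
  exact Finsupp.prod_add_index' (by simp) (fun j m n => zpow_add₀ (Circle.coe_ne_zero _) m n)

lemma monomial_ne_zero (α : ℕ →₀ ℤ) (z : Polytorus) : monomial α z ≠ 0 := by
  rw [← norm_ne_zero_iff, norm_monomial]; exact one_ne_zero

lemma monomial_neg (α : ℕ →₀ ℤ) (z : Polytorus) :
    monomial (-α) z = (starRingEnd ℂ) (monomial α z) := by
  have h : monomial (-α) z * monomial α z = 1 := by
    rw [← monomial_add]; simp [monomial_zero]
  have h2 : (starRingEnd ℂ) (monomial α z) * monomial α z = 1 := by
    rw [mul_comm, Complex.mul_conj, Complex.normSq_eq_norm_sq, norm_monomial]; simp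
  exact mul_right_cancel₀ (monomial_ne_zero α z) (h.trans h2.symm)

lemma monomial_mul (α : ℕ →₀ ℤ) (w z : Polytorus) :
    monomial α (w * z) = monomial α w * monomial α z := by
  simp [monomial, Finsupp.prod, mul_zpow, Finset.prod_mul_distrib]

lemma monomial_single (j : ℕ) (n : ℤ) (z : Polytorus) :
    monomial (Finsupp.single j n) z = (z j : ℂ) ^ n := by
  simp [monomial]

lemma monomial_mulSingle (α : ℕ →₀ ℤ) (j : ℕ) (w : Circle) :
    monomial α (Pi.mulSingle j w) = (w : ℂ) ^ α j := by
  unfold monomial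
  rw [Finsupp.prod_eq_single j]
  · simp
  · intro i _ hij
    simp [Pi.mulSingle_eq_of_ne hij]
  · simp

/-! ### Symmetries of the measure -/

lemma measurePreserving_rotation (w : Polytorus) :
    MeasurePreserving (fun z : Polytorus => w * z) torusMeasure torusMeasure := by
  refine ⟨by fun_prop, ?_⟩
  have h := Measure.infinitePi_map_pi (fun _ : ℕ => circleMeasure)
    (f := fun i x => w i * x) (fun i => by fun_prop)
  have h2 : (fun i => circleMeasure.map (fun x => w i * x)) = fun _ : ℕ => circleMeasure := by
    funext i
    exact map_mul_left_eq_self circleMeasure (w i)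
  unfold torusMeasure
  conv_rhs => rw [← h2]
  exact h

lemma measurePreserving_precomp {σ : ℕ → ℕ} (hσ : Function.Injective σ) :
    MeasurePreserving (fun z : Polytorus => z ∘ σ) torusMeasure torusMeasure :=
  ⟨measurable_pi_lambda _ fun i => measurable_pi_apply (σ i),
    Measure.map_infinitePi_infinitePi_of_inj (P := fun _ : ℕ => circleMeasure) hσ⟩

/-- Interleaving two points of the polytorus. -/
def interleave (p : Polytorus × Polytorus) : Polytorus :=
  fun i => Sum.elim p.1 p.2 (Equiv.natSumNatEquivNat.symm i)

lemma interleave_comp_even (p : Polytorus × Polytorus) :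
    interleave p ∘ (fun i => 2 * i) = p.1 := by
  funext i
  have : Equiv.natSumNatEquivNat.symm (2 * i) = Sum.inl i := by
    rw [Equiv.symm_apply_eq]; simp
  simp [interleave, this]

lemma interleave_comp_odd (p : Polytorus × Polytorus) :
    interleave p ∘ (fun i => 2 * i + 1) = p.2 := by
  funext i
  have : Equiv.natSumNatEquivNat.symm (2 * i + 1) = Sum.inr i := by
    rw [Equiv.symm_apply_eq]; simp
  simp [interleave, this]

lemma measurable_interleave : Measurable interleave := by
  refine measurable_pi_lambda _ fun i => ?_
  unfold interleave
  rcases Equiv.natSumNatEquivNat.symm i with j | j <;> simp <;> fun_prop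

lemma even_injective : Function.Injective (fun i : ℕ => 2 * i) := fun a b h => by
  simpa using h

lemma odd_injective : Function.Injective (fun i : ℕ => 2 * i + 1) := fun a b h => by
  simpa using h

lemma prod_even_mul_prod_odd {M : Type*} [CommMonoid M] (s : Finset ℕ) (h : ℕ → M) :
    (∏ i ∈ s.preimage (fun i => 2 * i) even_injective.injOn, h (2 * i)) *
      (∏ i ∈ s.preimage (fun i => 2 * i + 1) odd_injective.injOn, h (2 * i + 1)) =
        ∏ i ∈ s, h i := by
  classical
  rw [Finset.prod_preimage' (fun i => 2 * i) s even_injective.injOn h,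
    Finset.prod_preimage' (fun i => 2 * i + 1) s odd_injective.injOn h,
    ← Finset.prod_filter_mul_prod_filter_not s (fun i => i ∈ Set.range (fun i : ℕ => 2 * i))]
  congr 1
  refine Finset.prod_congr (Finset.filter_congr fun i _ => ?_) fun _ _ => rfl
  simp only [Set.mem_range]
  constructor
  · rintro ⟨y, rfl⟩ ⟨x, hx⟩; omega
  · intro hx
    refine ⟨i / 2, ?_⟩
    have : ¬ (2 * (i / 2) = i) := fun h => hx ⟨_, h⟩
    omega

/-- The measure of a finite cylinder factors according to the parity of the index, and cylinders
determine the infinite product measure. -/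
lemma measurePreserving_interleave :
    MeasurePreserving interleave (torusMeasure.prod torusMeasure) torusMeasure := by
  refine ⟨measurable_interleave, ?_⟩
  refine Measure.eq_infinitePi _ fun s t ht => ?_
  rw [Measure.map_apply measurable_interleave (.pi s.countable_toSet fun _ _ => ht _)]
  have : interleave ⁻¹' ((s : Set ℕ).pi t) =
      ((s.preimage (fun i => 2 * i) even_injective.injOn : Finset ℕ) : Set ℕ).pi
          (fun i => t (2 * i)) ×ˢ
        ((s.preimage (fun i => 2 * i + 1) odd_injective.injOn : Finset ℕ) : Set ℕ).pi
          (fun i => t (2 * i + 1)) := by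
    ext p
    have he := fun i => congrFun (interleave_comp_even p) i
    have ho := fun i => congrFun (interleave_comp_odd p) i
    simp only [Function.comp] at he ho
    simp only [Set.mem_preimage, Set.mem_pi, Finset.mem_coe, Set.mem_prod, Finset.mem_preimage,
      ← he, ← ho]
    constructor
    · exact fun h => ⟨fun i hi => h _ hi, fun i hi => h _ hi⟩
    · rintro ⟨h1, h2⟩ i hi
      rcases Nat.even_or_odd' i with ⟨k, rfl | rfl⟩
      · exact h1 k hi
      · exact h2 k hi
  rw [this, Measure.prod_prod, torusMeasure, Measure.infinitePi_pi _ (fun i _ => ht _),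
    Measure.infinitePi_pi _ (fun i _ => ht _)]
  exact prod_even_mul_prod_odd s fun i => circleMeasure (t i)

lemma monomial_interleave (α : ℕ →₀ ℤ) (p : Polytorus × Polytorus) :
    monomial α (interleave p) =
      monomial (α.comapDomain (fun i => 2 * i) even_injective.injOn) p.1 *
        monomial (α.comapDomain (fun i => 2 * i + 1) odd_injective.injOn) p.2 := by
  have he := fun i => congrFun (interleave_comp_even p) i
  have ho := fun i => congrFun (interleave_comp_odd p) i
  simp only [Function.comp] at he ho
  unfold monomial Finsupp.prod
  rw [← prod_even_mul_prod_odd]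
  simp only [he, ho]
  rfl

/-! ### Orthogonality -/

/-- Supplies rotations that flip a sign, the device behind every vanishing integral below. -/
lemma exists_circle_zpow_eq_neg_one {m : ℤ} (hm : m ≠ 0) : ∃ w : Circle, (w : ℂ) ^ m = -1 := by
  have hm' : (m : ℂ) ≠ 0 := by exact_mod_cast hm
  refine ⟨Circle.exp (Real.pi / m), ?_⟩
  rw [Circle.coe_exp, ← Complex.exp_int_mul,
    show (m : ℂ) * (((Real.pi / m : ℝ) : ℂ) * Complex.I) = Real.pi * Complex.I by
      push_cast; field_simp]
  exact Complex.exp_pi_mul_I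

lemma integral_monomial (α : ℕ →₀ ℤ) (hα : α ≠ 0) : ∫ z, monomial α z ∂torusMeasure = 0 := by
  obtain ⟨j, hj⟩ := Finsupp.ne_iff.mp hα
  obtain ⟨w, hwα⟩ := exists_circle_zpow_eq_neg_one (by simpa using hj)
  have h := (measurePreserving_rotation (Pi.mulSingle j w)).integral_comp
    (MeasurableEquiv.mulLeft (Pi.mulSingle j w : Polytorus)).measurableEmbedding (monomial α)
  simp only [monomial_mul, monomial_mulSingle, hwα, integral_const_mul] at h
  have : (2 : ℂ) * ∫ z, monomial α z ∂torusMeasure = 0 := by linear_combination -h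
  simpa using this

lemma integrable_mul_conj_monomial {f : Polytorus → ℂ} (hf : Integrable f torusMeasure)
    (α : ℕ →₀ ℤ) :
    Integrable (fun z => f z * (starRingEnd ℂ) (monomial α z)) torusMeasure := by
  refine hf.mul_bdd (c := 1) ?_ ?_
  · exact (Complex.continuous_conj.comp (continuous_monomial α)).aestronglyMeasurable
  · exact Filter.Eventually.of_forall fun z => by simp [norm_monomial]

lemma coeff_sub {f g : Polytorus → ℂ} (hf : Integrable f torusMeasure)
    (hg : Integrable g torusMeasure) (α : ℕ →₀ ℤ) :
    coeff (f - g) α = coeff f α - coeff g α := by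
  unfold coeff
  rw [← integral_sub (integrable_mul_conj_monomial hf α) (integrable_mul_conj_monomial hg α)]
  simp [sub_mul]

lemma coeff_congr {f g : Polytorus → ℂ} (h : f =ᵐ[torusMeasure] g) (α : ℕ →₀ ℤ) :
    coeff f α = coeff g α :=
  integral_congr_ae (h.mono fun z hz => by simp [hz])

/-- Fourier coefficients are multiplicative for products in separate variables. -/
lemma coeff_mul_even_odd {f g : Polytorus → ℂ} (hf : AEStronglyMeasurable f torusMeasure)
    (hg : AEStronglyMeasurable g torusMeasure) (α : ℕ →₀ ℤ) :
    coeff (fun z => f (z ∘ fun i => 2 * i) * g (z ∘ fun i => 2 * i + 1)) α =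
      coeff f (α.comapDomain (fun i => 2 * i) even_injective.injOn) *
        coeff g (α.comapDomain (fun i => 2 * i + 1) odd_injective.injOn) := by
  unfold coeff
  trans ∫ z, f (z ∘ fun i => 2 * i) * g (z ∘ fun i => 2 * i + 1) *
    (starRingEnd ℂ) (monomial α z) ∂((torusMeasure.prod torusMeasure).map interleave)
  · rw [measurePreserving_interleave.map_eq]
  rw [integral_map, ← integral_prod_mul]
  · simp only [interleave_comp_even, interleave_comp_odd, monomial_interleave, map_mul]
    congr 1 with p
    ring
  · exact measurable_interleave.aemeasurable
  · rw [measurePreserving_interleave.map_eq]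
    refine ((hf.comp_measurePreserving (measurePreserving_precomp even_injective)).mul
      (hg.comp_measurePreserving (measurePreserving_precomp odd_injective))).mul ?_
    exact (Complex.continuous_conj.comp (continuous_monomial α)).aestronglyMeasurable

/-! ### Density of trigonometric polynomials and uniqueness of Fourier coefficients -/

/-- The monomial `z^α` as a continuous function. -/
noncomputable def monomialC (α : ℕ →₀ ℤ) : C(Polytorus, ℂ) := ⟨monomial α, continuous_monomial α⟩

/-- The star algebra of trigonometric polynomials. -/
noncomputable def trigPolynomials : StarSubalgebra ℂ C(Polytorus, ℂ) where
  toSubalgebra := Algebra.adjoin ℂ (Set.range monomialC)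
  star_mem' := by
    change Algebra.adjoin ℂ (Set.range monomialC) ≤ star (Algebra.adjoin ℂ (Set.range monomialC))
    refine Algebra.adjoin_le ?_
    rintro _ ⟨α, rfl⟩
    refine Algebra.subset_adjoin ⟨-α, ?_⟩
    ext z
    simp [monomialC, monomial_neg]

lemma trigPolynomials_toSubmodule :
    trigPolynomials.toSubalgebra.toSubmodule = Submodule.span ℂ (Set.range monomialC) := by
  apply Algebra.adjoin_eq_span_of_subset
  refine .trans (fun x ↦ Submonoid.closure_induction (fun _ ↦ id) ⟨0, ?_⟩ ?_)
    Submodule.subset_span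
  · ext z
    simp [monomialC, monomial_zero]
  · rintro _ _ _ _ ⟨m, rfl⟩ ⟨n, rfl⟩
    refine ⟨m + n, ?_⟩
    ext z
    simp [monomialC, monomial_add]

lemma trigPolynomials_separatesPoints : trigPolynomials.SeparatesPoints := by
  intro x y hxy
  rw [Ne, funext_iff, not_forall] at hxy
  obtain ⟨i, hi⟩ := hxy
  refine ⟨_, ⟨monomialC (Finsupp.single i 1), Algebra.subset_adjoin ⟨_, rfl⟩, rfl⟩, ?_⟩
  simpa [monomialC, monomial_single, Circle.coe_inj] using hi

/-- Stone–Weierstrass; the generated algebra is already the linear span because monomials are closed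
under products. -/
lemma span_monomialC_topologicalClosure :
    (Submodule.span ℂ (Set.range monomialC)).topologicalClosure = ⊤ := by
  rw [← trigPolynomials_toSubmodule]
  exact congr_arg (Subalgebra.toSubmodule <| StarSubalgebra.toSubalgebra ·)
    (ContinuousMap.starSubalgebra_topologicalClosure_eq_top_of_separatesPoints _
      trigPolynomials_separatesPoints)

lemma integrable_mul_continuousMap {h : Polytorus → ℂ} (hh : Integrable h torusMeasure)
    (φ : C(Polytorus, ℂ)) : Integrable (fun z => h z * φ z) torusMeasure :=
  hh.mul_bdd (c := ‖φ‖) φ.continuous.aestronglyMeasurable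
    (Filter.Eventually.of_forall fun z => φ.norm_coe_le_norm z)

/-- Integration against an integrable function, as a functional on continuous functions. -/
noncomputable def integralFunctional {h : Polytorus → ℂ} (hh : Integrable h torusMeasure) :
    C(Polytorus, ℂ) →L[ℂ] ℂ :=
  LinearMap.mkContinuous
    { toFun := fun φ => ∫ z, h z * φ z ∂torusMeasure
      map_add' := fun φ ψ => by
        rw [← integral_add (integrable_mul_continuousMap hh φ) (integrable_mul_continuousMap hh ψ)]
        simp [mul_add]
      map_smul' := fun c φ => by
        rw [RingHom.id_apply, ← integral_smul]
        refine integral_congr_ae (Filter.Eventually.of_forall fun z => ?_)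
        simp only [ContinuousMap.smul_apply, smul_eq_mul]
        ring }
    (∫ z, ‖h z‖ ∂torusMeasure) (fun φ => by
      rw [← integral_mul_const]
      refine norm_integral_le_of_norm_le (hh.norm.mul_const _)
        (Filter.Eventually.of_forall fun z => ?_)
      rw [norm_mul]
      exact mul_le_mul_of_nonneg_left (φ.norm_coe_le_norm z) (norm_nonneg _))

/-- An integrable function on the polytorus with vanishing Fourier coefficients is zero. -/
theorem ae_eq_zero_of_coeff_eq_zero {h : Polytorus → ℂ} (hh : Integrable h torusMeasure)
    (h0 : ∀ α, coeff h α = 0) : h =ᵐ[torusMeasure] 0 := by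
  have hfun : ∀ φ : C(Polytorus, ℂ), ∫ z, h z * φ z ∂torusMeasure = 0 := by
    intro φ
    have hle : (Submodule.span ℂ (Set.range monomialC)).topologicalClosure ≤
        LinearMap.ker (integralFunctional hh).toLinearMap := by
      refine Submodule.topologicalClosure_minimal _ ?_ (integralFunctional hh).isClosed_ker
      rw [Submodule.span_le]
      rintro _ ⟨α, rfl⟩
      have := h0 (-α)
      simp only [coeff, monomial_neg, RingHomCompTriple.comp_apply, RingHom.id_apply] at this
      exact this
    rw [span_monomialC_topologicalClosure] at hle
    exact hle (Submodule.mem_top (x := φ))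
  -- Indicators of closed sets are pointwise limits of continuous functions with values in `[0, 1]`,
  -- so dominated convergence carries `hfun` over to them.
  refine ae_eq_zero_of_forall_setIntegral_isClosed_eq_zero hh fun F hF => ?_
  have hlim : Filter.Tendsto
      (fun n => ∫ z, h z * ((hF.apprSeq n z : ℝ≥0) : ℝ) ∂torusMeasure) Filter.atTop
      (nhds (∫ z, F.indicator h z ∂torusMeasure)) := by
    refine tendsto_integral_of_dominated_convergence (fun z => ‖h z‖) (fun n => ?_) hh.norm
      (fun n => Filter.Eventually.of_forall fun z => ?_) (Filter.Eventually.of_forall fun z => ?_)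
    · exact hh.aestronglyMeasurable.mul (by fun_prop :
        Continuous fun z => (((hF.apprSeq n z : ℝ≥0) : ℝ) : ℂ)).aestronglyMeasurable
    · rw [norm_mul, Complex.norm_real, Real.norm_of_nonneg (NNReal.coe_nonneg _)]
      refine mul_le_of_le_one_right (norm_nonneg _) ?_
      exact_mod_cast HasOuterApproxClosed.apprSeq_apply_le_one hF n z
    · have h1 := tendsto_pi_nhds.mp (HasOuterApproxClosed.tendsto_apprSeq hF) z
      have h2 : Filter.Tendsto (fun n => (((hF.apprSeq n z : ℝ≥0) : ℝ) : ℂ)) Filter.atTop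
          (nhds (((F.indicator (fun _ => (1 : ℝ≥0)) z : ℝ≥0) : ℝ) : ℂ)) :=
        ((Complex.continuous_ofReal.comp NNReal.continuous_coe).tendsto _).comp h1
      convert h2.const_mul (h z) using 2
      by_cases hz : z ∈ F <;> simp [hz]
  have hzero : ∀ n, ∫ z, h z * ((hF.apprSeq n z : ℝ≥0) : ℝ) ∂torusMeasure = 0 := fun n =>
    hfun ⟨fun z => (((hF.apprSeq n z : ℝ≥0) : ℝ) : ℂ), by fun_prop⟩
  simp only [hzero] at hlim
  rw [← integral_indicator hF.measurableSet]
  exact tendsto_nhds_unique hlim tendsto_const_nhds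

/-- Lets a norm bound for one representative, such as the one provided by `RieszBounded`, be used
for any other. -/
lemma IsRieszProjection.ae_eq {f g g' : Polytorus → ℂ} (h : IsRieszProjection f g)
    (h' : IsRieszProjection f g') : g =ᵐ[torusMeasure] g' := by
  have := ae_eq_zero_of_coeff_eq_zero (h.1.sub h'.1) fun α => by
    rw [coeff_sub h.1 h'.1, h.2, h'.2, sub_self]
  filter_upwards [this] with z hz
  exact sub_eq_zero.mp hz

/-! ### The projection on `L²` -/

lemma memLp_monomial (α : ℕ →₀ ℤ) (p : ℝ≥0∞) : MemLp (monomial α) p torusMeasure :=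
  MemLp.of_bound (measurable_monomial α).aestronglyMeasurable 1
    (Filter.Eventually.of_forall fun z => (norm_monomial α z).le)

/-- The monomial `z^α` as an element of `L²`. -/
noncomputable def monomialL2 (α : ℕ →₀ ℤ) : Lp ℂ 2 torusMeasure := (memLp_monomial α 2).toLp

lemma inner_monomialL2 (α : ℕ →₀ ℤ) (G : Lp ℂ 2 torusMeasure) :
    inner ℂ (monomialL2 α) G = coeff G α := by
  rw [L2.inner_def]
  refine integral_congr_ae ?_
  filter_upwards [(memLp_monomial α 2).coeFn_toLp] with z hz
  rw [monomialL2, hz]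
  simp [mul_comm]

lemma inner_monomialL2_monomialL2 {α β : ℕ →₀ ℤ} (h : α ≠ β) :
    inner ℂ (monomialL2 α) (monomialL2 β) = 0 := by
  rw [inner_monomialL2]
  refine (coeff_congr (memLp_monomial β 2).coeFn_toLp α).trans ?_
  unfold coeff
  simp_rw [← monomial_neg, ← monomial_add]
  exact integral_monomial _ (by rw [← sub_eq_add_neg]; exact sub_ne_zero.mpr h.symm)

/-- The Hardy space `H²` of the polytorus. -/
noncomputable def hardySpace : Submodule ℂ (Lp ℂ 2 torusMeasure) :=
  (Submodule.span ℂ (monomialL2 '' {α | ∀ j, 0 ≤ α j})).topologicalClosure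

instance instCompleteSpaceHardySpace : CompleteSpace hardySpace := by
  unfold hardySpace; infer_instance

/-- Square integrable functions have a Riesz projection, and it is a contraction. -/
theorem exists_isRieszProjection_of_memLp_two {f : Polytorus → ℂ} (hf : MemLp f 2 torusMeasure) :
    ∃ g, IsRieszProjection f g ∧ MemLp g 2 torusMeasure ∧
      eLpNorm g 2 torusMeasure ≤ eLpNorm f 2 torusMeasure := by
  set F := hf.toLp
  set G := hardySpace.starProjection F
  refine ⟨G, ⟨(Lp.memLp G).integrable one_le_two, fun α => ?_⟩, Lp.memLp G, ?_⟩
  · rw [← inner_monomialL2]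
    -- For `α ≥ 0` the self-adjoint projection fixes `z^α`, so the coefficient is kept; otherwise
    -- `z^α` is orthogonal to the Hardy space.
    split_ifs with hα
    · have hmem : monomialL2 α ∈ hardySpace :=
        Submodule.le_topologicalClosure _ (Submodule.subset_span ⟨α, hα, rfl⟩)
      rw [← Submodule.inner_starProjection_left_eq_right,
        Submodule.starProjection_eq_self_iff.mpr hmem, inner_monomialL2]
      exact coeff_congr hf.coeFn_toLp α
    · have hle : hardySpace ≤ LinearMap.ker (innerSL ℂ (monomialL2 α)).toLinearMap := by
        refine Submodule.topologicalClosure_minimal _ ?_ (innerSL ℂ (monomialL2 α)).isClosed_ker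
        rw [Submodule.span_le]
        rintro _ ⟨β, hβ, rfl⟩
        exact inner_monomialL2_monomialL2 fun h => hα (h ▸ hβ)
      exact hle (Submodule.starProjection_apply_mem _ F)
  · have h := hardySpace.norm_starProjection_apply_le F
    have h2 : ‖G‖ₑ ≤ ‖F‖ₑ := by
      rw [← ofReal_norm, ← ofReal_norm]; exact ENNReal.ofReal_le_ofReal h
    rwa [Lp.enorm_def, Lp.enorm_def, eLpNorm_congr_ae hf.coeFn_toLp] at h2

/-! ### Boundedness implies contractivity -/

/-- The two factors depend on disjoint sets of coordinates, so Tonelli splits the integral of the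
`p`-th power. -/
lemma eLpNorm_mul_even_odd {g : Polytorus → ℂ} (hg : AEStronglyMeasurable g torusMeasure)
    {p : ℝ≥0∞} (hp : p ≠ 0) (hp' : p ≠ ∞) :
    eLpNorm (fun z => g (z ∘ fun i => 2 * i) * g (z ∘ fun i => 2 * i + 1)) p torusMeasure =
      eLpNorm g p torusMeasure ^ 2 := by
  have hm : AEMeasurable (fun z => ‖g z‖ₑ ^ p.toReal) torusMeasure := by
    exact hg.enorm.pow_const _
  rw [eLpNorm_eq_lintegral_rpow_enorm_toReal hp hp', eLpNorm_eq_lintegral_rpow_enorm_toReal hp hp',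
    ← ENNReal.rpow_natCast, ← ENNReal.rpow_mul, mul_comm (1 / p.toReal), ENNReal.rpow_mul]
  congr 1
  have hsplit : ∀ z : Polytorus, ‖g (z ∘ fun i => 2 * i) * g (z ∘ fun i => 2 * i + 1)‖ₑ ^ p.toReal
      = ‖g (z ∘ fun i => 2 * i)‖ₑ ^ p.toReal * ‖g (z ∘ fun i => 2 * i + 1)‖ₑ ^ p.toReal := fun z =>
    by rw [enorm_mul, ENNReal.mul_rpow_of_nonneg _ _ ENNReal.toReal_nonneg]
  simp_rw [hsplit]
  trans ∫⁻ z, ‖g (z ∘ fun i => 2 * i)‖ₑ ^ p.toReal * ‖g (z ∘ fun i => 2 * i + 1)‖ₑ ^ p.toReal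
    ∂((torusMeasure.prod torusMeasure).map interleave)
  · rw [measurePreserving_interleave.map_eq]
  rw [lintegral_map' _ measurable_interleave.aemeasurable]
  · simp only [interleave_comp_even, interleave_comp_odd]
    rw [lintegral_prod_mul hm hm]
    norm_num [sq]
  · rw [measurePreserving_interleave.map_eq]
    exact (hm.comp_quasiMeasurePreserving
      (measurePreserving_precomp even_injective).quasiMeasurePreserving).mul
      (hm.comp_quasiMeasurePreserving
      (measurePreserving_precomp odd_injective).quasiMeasurePreserving)

lemma eLpNorm_top_mul_even_odd_le (f : Polytorus → ℂ) :
    eLpNorm (fun z => f (z ∘ fun i => 2 * i) * f (z ∘ fun i => 2 * i + 1)) ∞ torusMeasure ≤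
      eLpNorm f ∞ torusMeasure ^ 2 := by
  rw [eLpNorm_exponent_top, eLpNorm_exponent_top]
  refine eLpNormEssSup_le_of_ae_enorm_bound ?_
  have h := enorm_ae_le_eLpNormEssSup f torusMeasure
  filter_upwards [(measurePreserving_precomp even_injective).quasiMeasurePreserving.ae h,
    (measurePreserving_precomp odd_injective).quasiMeasurePreserving.ae h] with z h1 h2
  rw [enorm_mul, sq]
  exact mul_le_mul' h1 h2

/-- Coefficients multiply, and `α` is non-negative exactly when both its even and odd parts are. -/
lemma IsRieszProjection.mul_even_odd {f g : Polytorus → ℂ} (hf : Integrable f torusMeasure)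
    (h : IsRieszProjection f g) :
    IsRieszProjection (fun z => f (z ∘ fun i => 2 * i) * f (z ∘ fun i => 2 * i + 1))
      (fun z => g (z ∘ fun i => 2 * i) * g (z ∘ fun i => 2 * i + 1)) := by
  refine ⟨?_, fun α => ?_⟩
  · rw [← memLp_one_iff_integrable]
    refine ⟨(h.1.1.comp_measurePreserving (measurePreserving_precomp even_injective)).mul
      (h.1.1.comp_measurePreserving (measurePreserving_precomp odd_injective)), ?_⟩
    rw [eLpNorm_mul_even_odd h.1.1 one_ne_zero ENNReal.one_ne_top]
    exact ENNReal.pow_lt_top (memLp_one_iff_integrable.mpr h.1).2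
  · rw [coeff_mul_even_odd h.1.1 h.1.1, coeff_mul_even_odd hf.1 hf.1, h.2, h.2]
    have hiff : (∀ j, 0 ≤ α j) ↔
        (∀ j, 0 ≤ (α.comapDomain (fun i => 2 * i) even_injective.injOn) j) ∧
        (∀ j, 0 ≤ (α.comapDomain (fun i => 2 * i + 1) odd_injective.injOn) j) := by
      simp only [Finsupp.comapDomain_apply]
      refine ⟨fun H => ⟨fun j => H _, fun j => H _⟩, fun ⟨h1, h2⟩ i => ?_⟩
      rcases Nat.even_or_odd' i with ⟨k, rfl | rfl⟩
      exacts [h1 k, h2 k]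
    by_cases h1 : ∀ j, 0 ≤ (α.comapDomain (fun i => 2 * i) even_injective.injOn) j <;>
    by_cases h2 : ∀ j, 0 ≤ (α.comapDomain (fun i => 2 * i + 1) odd_injective.injOn) j
    · rw [if_pos h1, if_pos h2, if_pos (hiff.mpr ⟨h1, h2⟩)]
    · rw [if_neg h2, if_neg fun H => h2 (hiff.mp H).2, mul_zero]
    · rw [if_neg h1, if_neg fun H => h1 (hiff.mp H).1, zero_mul]
    · rw [if_neg h1, if_neg fun H => h1 (hiff.mp H).1, zero_mul]

/-- If `a / b > 1`, its powers would exceed `C`. The case `k = 0` excludes `a = ∞`, and `b = 0 < a`.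
-/
lemma le_of_forall_pow_two_pow_le_mul {a b : ℝ≥0∞} {C : ℝ≥0} (hb : b ≠ ∞)
    (h : ∀ k : ℕ, a ^ 2 ^ k ≤ C * b ^ 2 ^ k) : a ≤ b := by
  have ha : a ≠ ∞ := by
    rintro rfl
    have := h 0
    simp only [pow_zero, pow_one, top_le_iff] at this
    exact ENNReal.mul_ne_top ENNReal.coe_ne_top hb this
  lift a to ℝ≥0 using ha
  lift b to ℝ≥0 using hb
  norm_cast at h ⊢
  by_contra! hlt
  rcases eq_or_ne b 0 with rfl | hb0
  · have := h 0
    simp at this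
    simp [this] at hlt
  have hbpos : 0 < b := pos_iff_ne_zero.mpr hb0
  have h1 : 1 < a / b := by rwa [one_lt_div hbpos]
  obtain ⟨n, hn⟩ := pow_unbounded_of_one_lt C h1
  have h2 : (a / b) ^ n ≤ (a / b) ^ 2 ^ n := pow_le_pow_right₀ h1.le n.lt_two_pow_self.le
  have h3 : (a / b) ^ 2 ^ n ≤ C := by
    rw [div_pow, div_le_iff₀ (by positivity)]
    exact h n
  exact absurd (hn.trans_le (h2.trans h3)) (lt_irrefl _)

/-- If the Riesz projection is bounded from `L^∞` to `L^p` on the infinite polytorus, then it is a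
contraction. -/
theorem RieszBounded.eLpNorm_le {p : ℝ≥0∞} (hb : RieszBounded ∞ p) (hp : p ≠ 0) (hp' : p ≠ ∞)
    {f g : Polytorus → ℂ} (hf : MemLp f ∞ torusMeasure) (hfg : IsRieszProjection f g) :
    eLpNorm g p torusMeasure ≤ eLpNorm f ∞ torusMeasure := by
  obtain ⟨C, hC⟩ := hb
  refine le_of_forall_pow_two_pow_le_mul (C := C) hf.2.ne fun k => ?_
  induction k generalizing f g with
  | zero =>
    obtain ⟨g', hg', -, hle⟩ := hC f hf
    simpa [eLpNorm_congr_ae (hfg.ae_eq hg')] using hle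
  | succ k ih =>
    have hf2 : MemLp (fun z => f (z ∘ fun i => 2 * i) * f (z ∘ fun i => 2 * i + 1)) ∞
        torusMeasure :=
      ⟨(hf.1.comp_measurePreserving (measurePreserving_precomp even_injective)).mul
        (hf.1.comp_measurePreserving (measurePreserving_precomp odd_injective)),
        (eLpNorm_top_mul_even_odd_le f).trans_lt (ENNReal.pow_lt_top hf.2)⟩
    -- Applying the hypothesis to the product of two independent copies squares both norms, turning
    -- exponent `2^k` into `2^(k+1)`.
    have h := ih hf2 (hfg.mul_even_odd (hf.integrable le_top))
    rw [eLpNorm_mul_even_odd hfg.1.1 hp hp', ← pow_mul, ← pow_succ'] at h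
    refine h.trans ?_
    rw [pow_succ', pow_mul]
    gcongr
    exact eLpNorm_top_mul_even_odd_le f

/-! ### The set of admissible exponents -/

lemma RieszBounded.mono {p q r : ℝ≥0∞} (h : RieszBounded r p) (hqp : q ≤ p) :
    RieszBounded r q := by
  obtain ⟨C, hC⟩ := h
  refine ⟨C, fun f hf => ?_⟩
  obtain ⟨g, hg, hm, hle⟩ := hC f hf
  exact ⟨g, hg, hm.mono_exponent hqp,
    (eLpNorm_le_eLpNorm_of_exponent_le hqp hm.1).trans hle⟩

lemma two_mem_boundedExponents : 2 ∈ boundedExponents := by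
  refine ⟨one_le_two, 1, fun f hf => ?_⟩
  obtain ⟨g, hg, hm, hle⟩ := exists_isRieszProjection_of_memLp_two (hf.mono_exponent le_top)
  refine ⟨g, hg, hm, hle.trans ?_⟩
  simpa using eLpNorm_le_eLpNorm_of_exponent_le le_top hf.1

/-- On a finite measure space the `L^p` norm is lower semicontinuous in `p` from the left. -/
lemma eLpNorm_le_of_forall_lt {Ω : Type*} [MeasurableSpace Ω] {μ : Measure Ω} {g : Ω → ℂ}
    (hg : AEStronglyMeasurable g μ) {P : ℝ} (hP : 1 < P) {B : ℝ≥0∞}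
    (h : ∀ q : ℝ, 1 ≤ q → q < P → eLpNorm g (ENNReal.ofReal q) μ ≤ B) :
    eLpNorm g (ENNReal.ofReal P) μ ≤ B := by
  rcases eq_or_ne B ∞ with rfl | hB
  · exact le_top
  have hP0 : 0 < P := by linarith
  obtain ⟨q, -, hq, hqlim⟩ := exists_seq_strictMono_tendsto' hP
  have hnorm : ∀ r : ℝ, 0 < r → ∀ D : ℝ≥0∞, (eLpNorm g (ENNReal.ofReal r) μ ≤ D ↔
      ∫⁻ z, ‖g z‖ₑ ^ r ∂μ ≤ D ^ r) := by
    intro r hr D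
    rw [eLpNorm_eq_lintegral_rpow_enorm_toReal (by simpa using hr) ENNReal.ofReal_ne_top,
      ENNReal.toReal_ofReal hr.le, one_div, ENNReal.rpow_inv_le_iff hr]
  rw [hnorm P hP0]
  have hcont : ∀ x : ℝ≥0∞, x ≠ ∞ →
      Filter.Tendsto (fun n => x ^ q n) Filter.atTop (nhds (x ^ P)) := by
    intro x hx
    lift x to ℝ≥0 using hx
    have h1 : Filter.Tendsto (fun n => x ^ q n) Filter.atTop (nhds (x ^ P)) := by
      rw [← NNReal.tendsto_coe]
      simp only [NNReal.coe_rpow]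
      exact (Real.continuousAt_const_rpow' hP0.ne').tendsto.comp hqlim
    rw [← ENNReal.coe_rpow_of_nonneg x hP0.le]
    refine (ENNReal.tendsto_coe.mpr h1).congr fun n => ?_
    rw [ENNReal.coe_rpow_of_nonneg x (by linarith [(hq n).1])]
  -- Fatou's lemma along exponents increasing strictly to `P`.
  calc ∫⁻ z, ‖g z‖ₑ ^ P ∂μ
      = ∫⁻ z, Filter.liminf (fun n => ‖g z‖ₑ ^ q n) Filter.atTop ∂μ := by
        congr 1 with z
        exact (hcont _ enorm_ne_top).liminf_eq.symm
    _ ≤ Filter.liminf (fun n => ∫⁻ z, ‖g z‖ₑ ^ q n ∂μ) Filter.atTop :=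
        lintegral_liminf_le' fun n => hg.enorm.pow_const _
    _ ≤ Filter.liminf (fun n => B ^ q n) Filter.atTop := by
        refine Filter.liminf_le_liminf (Filter.Eventually.of_forall fun n => ?_)
        have h1 := (hq n).1
        exact (hnorm _ (by linarith) B).mp (h _ h1.le (hq n).2)
    _ = B ^ P := (hcont _ hB).liminf_eq

/-- The critical exponent is attained. -/
theorem isGreatest_criticalExponent (h : criticalExponent ≠ ∞) :
    IsGreatest boundedExponents criticalExponent := by
  refine ⟨?_, fun p hp => le_sSup hp⟩
  have h2 : (2 : ℝ≥0∞) ≤ criticalExponent := le_sSup two_mem_boundedExponents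
  -- The constant `1` works because contractivity holds at every smaller exponent, always for the
  -- same `L²` projection `g`.
  refine ⟨one_le_two.trans h2, 1, fun f hf => ?_⟩
  obtain ⟨g, hg, hm, -⟩ := exists_isRieszProjection_of_memLp_two (hf.mono_exponent le_top)
  have hle : eLpNorm g criticalExponent torusMeasure ≤ eLpNorm f ∞ torusMeasure := by
    rw [← ENNReal.ofReal_toReal h]
    have h2' : 2 ≤ criticalExponent.toReal := by
      simpa using ENNReal.toReal_mono h h2
    refine eLpNorm_le_of_forall_lt hm.1 (by linarith) fun q hq1 hq => ?_
    have hlt : ENNReal.ofReal q < criticalExponent := by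
      rw [← ENNReal.ofReal_toReal h]
      exact (ENNReal.ofReal_lt_ofReal_iff (by linarith)).mpr hq
    obtain ⟨p, hp, hqp⟩ := lt_sSup_iff.mp hlt
    refine (hp.2.mono hqp.le).eLpNorm_le ?_ ENNReal.ofReal_ne_top hf hg
    simpa using by linarith
  refine ⟨g, hg, ⟨hm.1, hle.trans_lt hf.2⟩, ?_⟩
  simpa using hle

/-! ### Normalized sums of the coordinates -/

/-- The normalized sum `(z_1 + ⋯ + z_n) / √n`. -/
noncomputable def normalizedSum (n : ℕ) (z : Polytorus) : ℂ :=
  ((√n)⁻¹ : ℝ) * ∑ j ∈ Finset.range n, (z j : ℂ)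

/-- The unimodular factor of the normalized sum. -/
noncomputable def normalizedSumSign (n : ℕ) (z : Polytorus) : ℂ :=
  normalizedSum n z / ‖normalizedSum n z‖

lemma continuous_normalizedSum (n : ℕ) : Continuous (normalizedSum n) := by
  unfold normalizedSum; fun_prop

lemma measurable_normalizedSumSign (n : ℕ) : Measurable (normalizedSumSign n) :=
  (continuous_normalizedSum n).measurable.div
    (Complex.measurable_ofReal.comp (continuous_normalizedSum n).norm.measurable)

/-- Only an inequality, since at zeros of the sum the quotient is `0 / 0 = 0`. -/
lemma norm_normalizedSumSign_le (n : ℕ) (z : Polytorus) : ‖normalizedSumSign n z‖ ≤ 1 := by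
  unfold normalizedSumSign
  rw [norm_div, Complex.norm_real, norm_norm]
  exact div_self_le_one _

lemma normalizedSumSign_mul_conj (n : ℕ) (z : Polytorus) :
    normalizedSumSign n z * (starRingEnd ℂ) (normalizedSum n z) = ‖normalizedSum n z‖ := by
  unfold normalizedSumSign
  rcases eq_or_ne (normalizedSum n z) 0 with h | h
  · simp [h]
  · have h' : (‖normalizedSum n z‖ : ℂ) ≠ 0 := by simpa using h
    rw [div_mul_eq_mul_div, Complex.mul_conj, Complex.normSq_eq_norm_sq, div_eq_iff h']
    push_cast
    ring

lemma memLp_normalizedSumSign (n : ℕ) (p : ℝ≥0∞) :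
    MemLp (normalizedSumSign n) p torusMeasure :=
  MemLp.of_bound (measurable_normalizedSumSign n).aestronglyMeasurable 1
    (Filter.Eventually.of_forall fun z => norm_normalizedSumSign_le n z)

lemma integrable_continuousMap (φ : C(Polytorus, ℂ)) : Integrable φ torusMeasure :=
  Integrable.of_bound φ.continuous.aestronglyMeasurable ‖φ‖
    (Filter.Eventually.of_forall fun z => φ.norm_coe_le_norm z)

lemma integrable_normalizedSum (n : ℕ) : Integrable (normalizedSum n) torusMeasure :=
  integrable_continuousMap ⟨_, continuous_normalizedSum n⟩

/-- A homogeneity relation forces most Fourier coefficients to vanish. -/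
lemma coeff_eq_zero_of_rotation {f : Polytorus → ℂ} {w : Polytorus} {u : ℂ}
    (h : ∀ z, f (w * z) = u * f z) {α : ℕ →₀ ℤ}
    (hne : u * (starRingEnd ℂ) (monomial α w) ≠ 1) : coeff f α = 0 := by
  have hrot := (measurePreserving_rotation w).integral_comp
    (MeasurableEquiv.mulLeft w).measurableEmbedding
    (fun z => f z * (starRingEnd ℂ) (monomial α z))
  have heq : ∀ z, f (w * z) * (starRingEnd ℂ) (monomial α (w * z)) =
      (u * (starRingEnd ℂ) (monomial α w)) * (f z * (starRingEnd ℂ) (monomial α z)) := by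
    intro z
    rw [h, monomial_mul, map_mul]
    ring
  simp_rw [heq] at hrot
  rw [integral_const_mul] at hrot
  change _ * coeff f α = coeff f α at hrot
  have : (u * (starRingEnd ℂ) (monomial α w) - 1) * coeff f α = 0 := by
    linear_combination hrot
  exact (mul_eq_zero.mp this).resolve_left (sub_ne_zero.mpr hne)

lemma normalizedSum_const_mul (n : ℕ) (w : Circle) (z : Polytorus) :
    normalizedSum n ((fun _ => w) * z) = w * normalizedSum n z := by
  simp only [normalizedSum, Pi.mul_apply, Circle.coe_mul, ← Finset.mul_sum]
  ring

lemma normalizedSumSign_const_mul (n : ℕ) (w : Circle) (z : Polytorus) :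
    normalizedSumSign n ((fun _ => w) * z) = w * normalizedSumSign n z := by
  simp only [normalizedSumSign, normalizedSum_const_mul, mul_div_assoc, norm_mul, Circle.norm_coe,
    one_mul]

lemma normalizedSumSign_mulSingle_mul {n j : ℕ} (hj : n ≤ j) (w : Circle) (z : Polytorus) :
    normalizedSumSign n (Pi.mulSingle j w * z) = normalizedSumSign n z := by
  have : normalizedSum n (Pi.mulSingle j w * z) = normalizedSum n z := by
    unfold normalizedSum
    congr 1
    refine Finset.sum_congr rfl fun i hi => ?_
    have : i ≠ j := by have := Finset.mem_range.mp hi; omega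
    simp [Pi.mulSingle_eq_of_ne this]
  simp [normalizedSumSign, this]

lemma normalizedSumSign_comp_swap {n i j : ℕ} (hi : i < n) (hj : j < n) (z : Polytorus) :
    normalizedSumSign n (z ∘ Equiv.swap i j) = normalizedSumSign n z := by
  have : normalizedSum n (z ∘ Equiv.swap i j) = normalizedSum n z := by
    unfold normalizedSum
    congr 1
    refine Finset.sum_equiv (Equiv.swap i j) (fun k => ?_) (fun k _ => rfl)
    rcases eq_or_ne k i with rfl | hki
    · simp [hi, hj]
    rcases eq_or_ne k j with rfl | hkj
    · simp [hi, hj]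
    rw [Equiv.swap_apply_of_ne_of_ne hki hkj]
  simp [normalizedSumSign, this]

lemma monomial_const (α : ℕ →₀ ℤ) (w : Circle) :
    monomial α (fun _ => w) = (w : ℂ) ^ (∑ j ∈ α.support, α j) := by
  simp only [monomial, Finsupp.prod]
  induction α.support using Finset.induction_on with
  | empty => simp
  | insert a s ha ih =>
    rw [Finset.prod_insert ha, Finset.sum_insert ha, zpow_add₀ (Circle.coe_ne_zero w), ih]

lemma exists_eq_single_of_sum_eq_one {α : ℕ →₀ ℤ} (h0 : ∀ j, 0 ≤ α j)
    (h1 : ∑ j ∈ α.support, α j = 1) : ∃ j, α = Finsupp.single j 1 := by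
  have hne : α.support.Nonempty := by
    rw [Finset.nonempty_iff_ne_empty]
    intro h
    simp [h] at h1
  obtain ⟨j, hj⟩ := hne
  refine ⟨j, ?_⟩
  have hj0 : α j ≠ 0 := Finsupp.mem_support_iff.mp hj
  have hsum := Finset.add_sum_erase _ (fun j => α j) hj
  simp only [h1] at hsum
  have hnn : 0 ≤ ∑ i ∈ α.support.erase j, α i := Finset.sum_nonneg fun i _ => h0 i
  have hj1 : α j = 1 := by have := h0 j; omega
  have hz : ∑ i ∈ α.support.erase j, α i = 0 := by omega
  rw [Finset.sum_eq_zero_iff_of_nonneg fun i _ => h0 i] at hz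
  ext i
  rcases eq_or_ne i j with rfl | hij
  · simpa using hj1
  · rw [Finsupp.single_eq_of_ne hij]
    by_contra hi
    exact hi (hz i (Finset.mem_erase.mpr ⟨hij, Finsupp.mem_support_iff.mpr hi⟩))

/-- Homogeneity of degree one under diagonal rotations leaves only total degree one, which for `α ≥
0` means a single coordinate; coordinates from `n` on do not enter the function. -/
lemma coeff_normalizedSumSign_eq_zero {n : ℕ} {α : ℕ →₀ ℤ} (h0 : ∀ j, 0 ≤ α j)
    (h : ∀ j < n, α ≠ Finsupp.single j 1) : coeff (normalizedSumSign n) α = 0 := by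
  by_cases hsum : ∑ j ∈ α.support, α j = 1
  · obtain ⟨j, rfl⟩ := exists_eq_single_of_sum_eq_one h0 hsum
    have hj : n ≤ j := by
      by_contra! hlt
      exact h j hlt rfl
    obtain ⟨w, hw⟩ := exists_circle_zpow_eq_neg_one (one_ne_zero : (1 : ℤ) ≠ 0)
    refine coeff_eq_zero_of_rotation (w := Pi.mulSingle j w) (u := 1)
      (fun z => by rw [normalizedSumSign_mulSingle_mul hj, one_mul]) ?_
    rw [monomial_mulSingle, Finsupp.single_eq_same, hw]
    norm_num
  -- With `w ^ (|α| - 1) = -1` the diagonal rotation multiplies the integrand by `-1`.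
  · obtain ⟨w, hw⟩ := exists_circle_zpow_eq_neg_one (sub_ne_zero.mpr hsum)
    refine coeff_eq_zero_of_rotation (w := fun _ => w) (normalizedSumSign_const_mul n w) ?_
    rw [monomial_const]
    intro h1
    have hw0 : (w : ℂ) ≠ 0 := Circle.coe_ne_zero w
    have hconj : (w : ℂ) * (starRingEnd ℂ) (w : ℂ) = 1 := by
      rw [Complex.mul_conj, Complex.normSq_eq_norm_sq, Circle.norm_coe]; simp
    rw [zpow_sub_one₀ hw0] at hw
    have h2 : (w : ℂ) ^ (∑ j ∈ α.support, α j) = -w := by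
      field_simp at hw
      linear_combination hw
    rw [h2, map_neg] at h1
    have : (-1 : ℂ) = 1 := by linear_combination h1 + hconj
    norm_num at this

/-- Swapping coordinates shows that the `n` coefficients agree, and their sum divided by `√n` is the
integral of `sign · conj S = |S|`. -/
lemma coeff_normalizedSumSign_single {n j : ℕ} (hj : j < n) :
    coeff (normalizedSumSign n) (Finsupp.single j 1) =
      ((√n)⁻¹ : ℝ) * ((∫ z, ‖normalizedSum n z‖ ∂torusMeasure : ℝ) : ℂ) := by
  have hcongr : ∀ i < n, coeff (normalizedSumSign n) (Finsupp.single i 1) =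
      coeff (normalizedSumSign n) (Finsupp.single j 1) := by
    intro i hi
    have hmp := measurePreserving_precomp (Equiv.swap i j).injective
    have hme : MeasurableEmbedding (fun z : Polytorus => z ∘ Equiv.swap i j) :=
      (MeasurableEquiv.arrowCongr' (Equiv.swap i j)
        (MeasurableEquiv.refl Circle)).measurableEmbedding
    have := hmp.integral_comp hme (fun z => normalizedSumSign n z *
      (starRingEnd ℂ) (monomial (Finsupp.single i 1) z))
    unfold coeff
    rw [← this]
    simp only [normalizedSumSign_comp_swap hi hj]
    simp [monomial_single]
  have hn : (0 : ℝ) < n := by exact_mod_cast (Nat.zero_le j).trans_lt hj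
  have hsq : (√n : ℝ) * √n = n := Real.mul_self_sqrt hn.le
  have hs0 : (√n : ℝ) ≠ 0 := (Real.sqrt_pos.mpr hn).ne'
  have hsum : ((√n)⁻¹ : ℝ) * ∑ i ∈ Finset.range n,
      coeff (normalizedSumSign n) (Finsupp.single i 1) =
        ((∫ z, ‖normalizedSum n z‖ ∂torusMeasure : ℝ) : ℂ) := by
    unfold coeff
    rw [← integral_finsetSum _ fun i _ => integrable_mul_conj_monomial
      ((memLp_normalizedSumSign n 1).integrable le_rfl) _, ← integral_const_mul,
      ← integral_complex_ofReal]
    congr 1 with z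
    rw [← normalizedSumSign_mul_conj, ← Finset.mul_sum]
    conv_rhs => rw [normalizedSum]
    simp only [monomial_single, zpow_one, map_mul, map_sum, Complex.conj_ofReal]
    ring
  rw [Finset.sum_congr rfl fun i hi => hcongr i (Finset.mem_range.mp hi), Finset.sum_const,
    Finset.card_range, nsmul_eq_mul] at hsum
  rw [← hsum]
  have hsq' : ((√n : ℝ) : ℂ) * (√n : ℝ) = n := by exact_mod_cast hsq
  have hs0' : ((√n : ℝ) : ℂ) ≠ 0 := by exact_mod_cast hs0
  rw [← hsq']
  push_cast
  field_simp

lemma coeff_normalizedSum (n : ℕ) (α : ℕ →₀ ℤ) :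
    coeff (normalizedSum n) α =
      ((√n)⁻¹ : ℝ) * ∑ j ∈ Finset.range n, if α = Finsupp.single j 1 then 1 else 0 := by
  have hterm : ∀ j, ∫ z, monomial (Finsupp.single j 1 - α) z ∂torusMeasure =
      if α = Finsupp.single j 1 then 1 else 0 := by
    intro j
    split_ifs with h
    · simp [h, monomial_zero]
    · exact integral_monomial _ (sub_ne_zero.mpr (Ne.symm h))
  simp_rw [← hterm]
  rw [← integral_finsetSum _ fun j _ => show Integrable (monomial _) torusMeasure from
      integrable_continuousMap (monomialC _),
    ← integral_const_mul]
  unfold coeff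
  congr 1 with z
  simp only [normalizedSum, sub_eq_add_neg, monomial_add, monomial_neg, monomial_single, zpow_one,
    ← Finset.sum_mul]
  ring

lemma isRieszProjection_normalizedSumSign (n : ℕ) :
    IsRieszProjection (normalizedSumSign n)
      (fun z => ((∫ y, ‖normalizedSum n y‖ ∂torusMeasure : ℝ) : ℂ) * normalizedSum n z) := by
  refine ⟨(integrable_normalizedSum n).const_mul _, fun α => ?_⟩
  have hg : coeff (fun z => ((∫ y, ‖normalizedSum n y‖ ∂torusMeasure : ℝ) : ℂ) *
      normalizedSum n z) α =
      ((∫ y, ‖normalizedSum n y‖ ∂torusMeasure : ℝ) : ℂ) * coeff (normalizedSum n) α := by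
    unfold coeff
    rw [← integral_const_mul]
    congr 1 with z
    ring
  rw [hg, coeff_normalizedSum]
  by_cases hα : ∃ j < n, α = Finsupp.single j 1
  · obtain ⟨j, hj, rfl⟩ := hα
    have hpos : ∀ i, 0 ≤ (Finsupp.single j 1 : ℕ →₀ ℤ) i := by
      intro i
      rw [Finsupp.single_apply]
      split_ifs <;> simp
    rw [if_pos hpos, coeff_normalizedSumSign_single hj, Finset.sum_eq_single j]
    · simp only [if_true]
      ring
    · intro i _ hij
      rw [if_neg]
      intro h
      exact hij (Finsupp.single_left_injective one_ne_zero h).symm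
    · intro h
      exact absurd (Finset.mem_range.mpr hj) h
  · push Not at hα
    rw [Finset.sum_eq_zero fun j hj => if_neg (hα j (Finset.mem_range.mp hj))]
    split_ifs with h0
    · rw [coeff_normalizedSumSign_eq_zero h0 hα]
      simp
    · simp

/-- The necessary condition for boundedness given by the signs of sums of independent
variables. -/
theorem RieszBounded.eLpNorm_normalizedSum_mul_le {p : ℝ≥0∞} (hb : RieszBounded ∞ p) (hp : p ≠ 0)
    (hp' : p ≠ ∞) (n : ℕ) :
    eLpNorm (normalizedSum n) 1 torusMeasure * eLpNorm (normalizedSum n) p torusMeasure ≤ 1 := by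
  have h := hb.eLpNorm_le hp hp' (memLp_normalizedSumSign n ∞)
    (isRieszProjection_normalizedSumSign n)
  have h1 : eLpNorm (normalizedSumSign n) ∞ torusMeasure ≤ 1 := by
    rw [eLpNorm_exponent_top]
    refine eLpNormEssSup_le_of_ae_enorm_bound (Filter.Eventually.of_forall fun z => ?_)
    rw [← ofReal_norm]
    exact ENNReal.ofReal_le_one.mpr (norm_normalizedSumSign_le n z)
  have h2 := eLpNorm_const_smul ((∫ y, ‖normalizedSum n y‖ ∂torusMeasure : ℝ) : ℂ)
    (normalizedSum n) p torusMeasure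
  have h3 : eLpNorm (normalizedSum n) 1 torusMeasure =
      ‖((∫ y, ‖normalizedSum n y‖ ∂torusMeasure : ℝ) : ℂ)‖ₑ := by
    rw [eLpNorm_one_eq_lintegral_enorm, ← ofReal_integral_norm_eq_lintegral_enorm
      (integrable_normalizedSum n), ← ofReal_norm, Complex.norm_real, Real.norm_of_nonneg
      (integral_nonneg fun _ => norm_nonneg _)]
  rw [h3, ← h2]
  exact h.trans h1

end PolytorusRiesz

namespace PolytorusRiesz

open ProbabilityTheory Filter Topology

/-! ### The standard complex Gaussian -/

/-- The law of a standard complex Gaussian variable. -/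
noncomputable def complexGaussian : Measure ℂ :=
  volume.withDensity fun z => ENNReal.ofReal (Real.pi⁻¹ * Real.exp (-‖z‖ ^ 2))

lemma lintegral_rpow_complexGaussian {q : ℝ} (hq : 0 ≤ q) :
    ∫⁻ z, ENNReal.ofReal (‖z‖ ^ q) ∂complexGaussian =
      ENNReal.ofReal (Real.Gamma (1 + q / 2)) := by
  have hint := Complex.integral_rpow_mul_exp_neg_rpow (p := 2) (q := q) one_le_two (by linarith)
  have hG : 0 < Real.Gamma ((q + 2) / 2) := Real.Gamma_pos_of_pos (by linarith)
  -- The integral of a non-integrable function is `0` by convention, but the known value is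
  -- positive.
  have hI : Integrable (fun z : ℂ => ‖z‖ ^ q * Real.exp (-‖z‖ ^ (2 : ℝ))) := by
    by_contra h
    rw [integral_undef h] at hint
    have : 0 < 2 * Real.pi / 2 * Real.Gamma ((q + 2) / 2) := by positivity
    linarith
  rw [complexGaussian, lintegral_withDensity_eq_lintegral_mul _ (by fun_prop) (by fun_prop)]
  simp only [Pi.mul_apply]
  have heq : ∀ z : ℂ, ENNReal.ofReal (Real.pi⁻¹ * Real.exp (-‖z‖ ^ 2)) * ENNReal.ofReal (‖z‖ ^ q) =
      ENNReal.ofReal (Real.pi⁻¹ * (‖z‖ ^ q * Real.exp (-‖z‖ ^ (2 : ℝ)))) := by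
    intro z
    rw [← ENNReal.ofReal_mul (by positivity), Real.rpow_two]
    congr 1
    ring
  simp_rw [heq]
  rw [← ofReal_integral_eq_lintegral_ofReal (hI.const_mul _)
    (Eventually.of_forall fun z => by positivity), integral_const_mul, hint]
  congr 1
  have hpi := Real.pi_ne_zero
  rw [show (q + 2) / 2 = 1 + q / 2 by ring]
  field_simp

instance instIsProbabilityMeasureComplexGaussian : IsProbabilityMeasure complexGaussian := by
  constructor
  simpa using lintegral_rpow_complexGaussian le_rfl

/-- Written as a real standard Gaussian characteristic function at `‖t‖ / √2`, the form met in the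
one-dimensional limit theorem. -/
lemma charFun_complexGaussian (t : ℂ) :
    charFun complexGaussian t = Real.exp (-(‖t‖ / √2) ^ 2 / 2) := by
  have h := GaussianFourier.integral_cexp_neg_mul_sq_norm_add (V := ℂ) (b := 1) (by simp)
    Complex.I t
  rw [charFun_apply, complexGaussian, integral_withDensity_eq_integral_toReal_smul (by fun_prop)
    (Eventually.of_forall fun z => ENNReal.ofReal_lt_top)]
  have heq : ∀ z : ℂ, (ENNReal.ofReal (Real.pi⁻¹ * Real.exp (-‖z‖ ^ 2))).toReal •
      Complex.exp (inner ℝ z t * Complex.I) =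
      (Real.pi : ℂ)⁻¹ * Complex.exp (-1 * ‖z‖ ^ 2 + Complex.I * inner ℝ t z) := by
    intro z
    rw [ENNReal.toReal_ofReal (by positivity), Complex.exp_add, Complex.real_smul,
      real_inner_comm]
    push_cast
    ring_nf
  simp_rw [heq]
  rw [integral_const_mul, h]
  have hpi : (Real.pi : ℂ) ≠ 0 := by exact_mod_cast Real.pi_ne_zero
  have h2 : (√2 : ℝ) ^ 2 = 2 := Real.sq_sqrt zero_le_two
  rw [Complex.finrank_real_complex]
  norm_num
  congr 1
  rw [div_pow]
  norm_cast
  rw [h2]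
  push_cast
  ring

/-! ### The central limit theorem for the coordinates -/

/-- The real part of a coordinate in direction `u`, normalized to have variance one. -/
noncomputable def directionalPart (u : ℂ) (w : Circle) : ℝ := √2 * inner ℝ (w : ℂ) u

lemma continuous_directionalPart (u : ℂ) : Continuous (directionalPart u) := by
  unfold directionalPart; fun_prop

/-- Expansion in characters, so that mean and variance follow from orthogonality. -/
lemma directionalPart_eq (u : ℂ) (z : Polytorus) (j : ℕ) :
    (directionalPart u (z j) : ℂ) = (√2 : ℝ) / 2 *
      (monomial (Finsupp.single j 1) z * (starRingEnd ℂ) u +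
        monomial (Finsupp.single j (-1)) z * u) := by
  have hneg : (Finsupp.single j (-1) : ℕ →₀ ℤ) = -Finsupp.single j 1 := by simp
  rw [hneg, monomial_neg, monomial_single, zpow_one, directionalPart, Complex.inner]
  apply Complex.ext
  · simp
    ring
  · simp
    ring

lemma integral_directionalPart (u : ℂ) (j : ℕ) :
    ∫ z, directionalPart u (z j) ∂torusMeasure = 0 := by
  have h : ∫ z, (directionalPart u (z j) : ℂ) ∂torusMeasure = 0 := by
    simp_rw [directionalPart_eq]
    rw [integral_const_mul, integral_add, integral_mul_const, integral_mul_const,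
      integral_monomial _ (by simp), integral_monomial _ (by simp)]
    · simp
    · exact ((memLp_monomial _ 1).integrable le_rfl).mul_const _
    · exact ((memLp_monomial _ 1).integrable le_rfl).mul_const _
  rw [integral_complex_ofReal] at h
  exact_mod_cast h

lemma integral_directionalPart_sq {u : ℂ} (hu : ‖u‖ = 1) (j : ℕ) :
    ∫ z, directionalPart u (z j) ^ 2 ∂torusMeasure = 1 := by
  have h2 : ((√2 : ℝ) : ℂ) * (√2 : ℝ) = 2 := by
    exact_mod_cast Real.mul_self_sqrt zero_le_two
  have hu2 : (starRingEnd ℂ) u * u = 1 := by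
    rw [mul_comm, Complex.mul_conj, Complex.normSq_eq_norm_sq, hu]; simp
  have h : ∫ z, ((directionalPart u (z j) ^ 2 : ℝ) : ℂ) ∂torusMeasure = 1 := by
    have hexp : ∀ z, ((directionalPart u (z j) ^ 2 : ℝ) : ℂ) =
        monomial (Finsupp.single j 2) z * ((starRingEnd ℂ) u ^ 2 / 2) +
          (1 + monomial (Finsupp.single j (-2)) z * (u ^ 2 / 2)) := by
      intro z
      have h1 : monomial (Finsupp.single j 1) z * monomial (Finsupp.single j (-1)) z = 1 := by
        rw [← monomial_add, ← Finsupp.single_add]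
        simp [monomial_zero]
      have h3 : monomial (Finsupp.single j 2) z = monomial (Finsupp.single j 1) z ^ 2 := by
        rw [sq, ← monomial_add, ← Finsupp.single_add]; norm_num
      have h4 : monomial (Finsupp.single j (-2)) z = monomial (Finsupp.single j (-1)) z ^ 2 := by
        rw [sq, ← monomial_add, ← Finsupp.single_add]; norm_num
      push_cast
      rw [directionalPart_eq, h3, h4]
      generalize monomial (Finsupp.single j 1) z = a at *
      generalize monomial (Finsupp.single j (-1)) z = b at *
      generalize (starRingEnd ℂ) u = v at *
      linear_combination (1 / 4 * (a * v + b * u) ^ 2) * h2 + v * u * h1 + hu2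
    have hm : ∀ α : ℕ →₀ ℤ, Integrable (monomial α) torusMeasure := fun α =>
      (memLp_monomial _ 1).integrable le_rfl
    simp_rw [hexp]
    rw [integral_add ((hm _).mul_const _) (show Integrable (fun z => 1 +
      monomial (Finsupp.single j (-2)) z * (u ^ 2 / 2)) torusMeasure from
        (integrable_const _).add ((hm _).mul_const _)), integral_add (integrable_const _) ((hm _).mul_const _), integral_mul_const,
      integral_mul_const, integral_monomial _ (by simp), integral_monomial _ (by simp)]
    simp
  rw [integral_complex_ofReal] at h
  exact_mod_cast h

/-- Cramér–Wold: at `t` only the component along `u = t / ‖t‖` matters, and this is a normalized sum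
of i.i.d. real variables of mean `0` and, after scaling by `√2`, variance `1`. -/
lemma tendsto_charFun_normalizedSum (t : ℂ) :
    Tendsto (fun n => charFun (torusMeasure.map (normalizedSum n)) t) atTop
      (𝓝 (charFun complexGaussian t)) := by
  obtain ⟨u, hu, htu⟩ : ∃ u : ℂ, ‖u‖ = 1 ∧ t = (‖t‖ : ℝ) • u := by
    rcases eq_or_ne t 0 with rfl | ht
    · exact ⟨1, by simp, by simp⟩
    · have ht' : (‖t‖ : ℂ) ≠ 0 := by simpa using ht
      refine ⟨t / ‖t‖, ?_, ?_⟩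
      · rw [norm_div, Complex.norm_real, norm_norm, div_self (by simpa using ht)]
      · rw [Complex.real_smul, mul_div_cancel₀ _ ht']
  have hmeas : ∀ j, Measurable fun z : Polytorus => directionalPart u (z j) := fun j =>
    (continuous_directionalPart u).measurable.comp (measurable_pi_apply j)
  have hindep : iIndepFun (fun j (z : Polytorus) => directionalPart u (z j)) torusMeasure :=
    iIndepFun_infinitePi (P := fun _ : ℕ => circleMeasure)
      (X := fun _ => directionalPart u) fun _ => (continuous_directionalPart u).measurable
  have hident : ∀ j, IdentDistrib (fun z : Polytorus => directionalPart u (z j))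
      (fun z : Polytorus => directionalPart u (z 0)) torusMeasure torusMeasure := by
    intro j
    have he : ∀ i, torusMeasure.map (fun z : Polytorus => directionalPart u (z i)) =
        circleMeasure.map (directionalPart u) := by
      intro i
      have := Measure.map_map (μ := torusMeasure) (continuous_directionalPart u).measurable
        (measurable_pi_apply i)
      rw [torusMeasure, Measure.infinitePi_map_eval] at this
      exact this.symm
    exact ⟨(hmeas j).aemeasurable, (hmeas 0).aemeasurable, (he j).trans (he 0).symm⟩
  have hlim := tendsto_charFun_inv_sqrt_mul_pow (hmeas 0).aemeasurable
    (integral_directionalPart u 0) (integral_directionalPart_sq hu 0) (‖t‖ / √2)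
  rw [charFun_complexGaussian]
  refine (hlim.congr fun n => ?_).trans (le_of_eq ?_)
  · rw [← charFun_inv_sqrt_mul_sum hindep hident, charFun_apply_real, charFun_apply,
      integral_map, integral_map]
    · congr 1 with z
      congr 2
      norm_cast
      have h2 : √2 ≠ 0 := by positivity
      conv_rhs => rw [htu]
      simp only [directionalPart, normalizedSum, ← Complex.real_smul, real_inner_smul_left,
        real_inner_smul_right, sum_inner, ← Finset.mul_sum]
      field_simp
    · exact (continuous_normalizedSum n).measurable.aemeasurable
    · exact (by fun_prop : Continuous _).aestronglyMeasurable
    · exact (Measurable.const_mul (Finset.measurable_fun_sum _ fun j _ => hmeas j) _).aemeasurable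
    · exact (by fun_prop : Continuous _).aestronglyMeasurable
  · norm_cast

/-- The moments of the normalized sums are asymptotically at least the Gaussian ones. -/
lemma ofReal_Gamma_le_liminf {q : ℝ} (hq : 0 < q) :
    ENNReal.ofReal (Real.Gamma (1 + q / 2)) ≤
      liminf (fun n => ∫⁻ z, ‖normalizedSum n z‖ₑ ^ q ∂torusMeasure) atTop := by
  have hprob : ∀ n, IsProbabilityMeasure (torusMeasure.map (normalizedSum n)) := fun n =>
    Measure.isProbabilityMeasure_map (continuous_normalizedSum n).measurable.aemeasurable
  let ν : ℕ → ProbabilityMeasure ℂ := fun n => ⟨torusMeasure.map (normalizedSum n), hprob n⟩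
  let ν₀ : ProbabilityMeasure ℂ := ⟨complexGaussian, inferInstance⟩
  have hconv : Tendsto ν atTop (𝓝 ν₀) :=
    ProbabilityMeasure.tendsto_iff_tendsto_charFun.mpr tendsto_charFun_normalizedSum
  have hcont : Continuous fun z : ℂ => ‖z‖ ^ q :=
    continuous_norm.rpow_const fun _ => Or.inr hq.le
  -- The integrand is unbounded, but the portmanteau inequality for open sets gives the needed
  -- one-sided bound without uniform integrability.
  have h := lintegral_le_liminf_lintegral_of_forall_isOpen_measure_le_liminf_measure
    (μ := complexGaussian) (μs := fun n => torusMeasure.map (normalizedSum n)) hcont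
    (fun z => by positivity)
    (fun G hG => ProbabilityMeasure.le_liminf_measure_open_of_tendsto hconv hG)
  rw [lintegral_rpow_complexGaussian hq.le] at h
  refine h.trans (le_of_eq ?_)
  congr 1 with n
  rw [lintegral_map (by fun_prop) (continuous_normalizedSum n).measurable]
  congr 1 with z
  rw [← ENNReal.ofReal_rpow_of_nonneg (norm_nonneg _) hq.le, ofReal_norm]

/-- The exponents for which the Riesz projection is bounded satisfy a Gamma function bound. -/
theorem RieszBounded.Gamma_rpow_le {p : ℝ} (hp : 0 < p) (hb : RieszBounded ∞ (ENNReal.ofReal p)) :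
    Real.Gamma (3 / 2) * Real.Gamma (1 + p / 2) ^ (1 / p) ≤ 1 := by
  have hlow : ∀ q : ℝ, 0 < q → ∀ a < ENNReal.ofReal (Real.Gamma (1 + q / 2) ^ (1 / q)),
      ∀ᶠ n in atTop, a < eLpNorm (normalizedSum n) (ENNReal.ofReal q) torusMeasure := by
    intro q hq a ha
    have hG : 0 ≤ Real.Gamma (1 + q / 2) := (Real.Gamma_pos_of_pos (by linarith)).le
    rw [← ENNReal.ofReal_rpow_of_nonneg hG (by positivity), one_div,
      ENNReal.lt_rpow_inv_iff hq] at ha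
    filter_upwards [eventually_lt_of_lt_liminf (ha.trans_le (ofReal_Gamma_le_liminf hq))] with n hn
    rwa [eLpNorm_eq_lintegral_rpow_enorm_toReal (by simpa using hq) ENNReal.ofReal_ne_top,
      ENNReal.toReal_ofReal hq.le, one_div, ENNReal.lt_rpow_inv_iff hq]
  have hmul : ENNReal.ofReal (Real.Gamma (1 + 1 / 2) ^ (1 / (1 : ℝ))) *
      ENNReal.ofReal (Real.Gamma (1 + p / 2) ^ (1 / p)) ≤ 1 := by
    refine ENNReal.mul_le_of_forall_lt fun a ha b hb' => ?_
    obtain ⟨n, hn1, hn2⟩ := ((hlow 1 one_pos a ha).and (hlow p hp b hb')).exists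
    rw [ENNReal.ofReal_one] at hn1
    exact (mul_le_mul' hn1.le hn2.le).trans
      (hb.eLpNorm_normalizedSum_mul_le (by simpa using hp) ENNReal.ofReal_ne_top n)
  have hG1 : 0 < Real.Gamma (1 + 1 / 2) := Real.Gamma_pos_of_pos (by norm_num)
  rw [← ENNReal.ofReal_mul (by positivity), ENNReal.ofReal_le_one] at hmul
  norm_num at hmul ⊢
  exact hmul

end PolytorusRiesz

namespace PolytorusRiesz

open Filter Topology Set

/-! ### Asymptotic bounds for the logarithm of the Gamma function -/

lemma hasDerivAt_log_one_add_sub_log_one_sub {t : ℝ} (h0 : -1 < t) (h1 : t < 1) :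
    HasDerivAt (fun t : ℝ => Real.log (1 + t) - Real.log (1 - t)) (2 / (1 - t ^ 2)) t := by
  have ha : (1 + t) ≠ 0 := by linarith
  have hb : (1 - t) ≠ 0 := by linarith
  have hc : 1 - t ^ 2 ≠ 0 := by
    rw [show 1 - t ^ 2 = (1 + t) * (1 - t) by ring]; exact mul_ne_zero ha hb
  have h := (((hasDerivAt_id t).const_add 1).log ha).sub (((hasDerivAt_id t).const_sub 1).log hb)
  convert! h using 1
  simp only [id]
  rw [div_sub_div _ _ ha hb, div_eq_div_iff hc (mul_ne_zero ha hb)]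
  ring

lemma nonneg_of_deriv_nonneg {f f' : ℝ → ℝ} (hf : ∀ t ∈ Ico (0 : ℝ) 1, HasDerivAt f (f' t) t)
    (hf' : ∀ t ∈ Ico (0 : ℝ) 1, 0 ≤ f' t) (h0 : f 0 = 0) {t : ℝ} (ht : t ∈ Ico (0 : ℝ) 1) :
    0 ≤ f t := by
  have hmono : MonotoneOn f (Ico 0 1) := by
    refine monotoneOn_of_deriv_nonneg (convex_Ico 0 1)
      (fun t ht => (hf t ht).continuousAt.continuousWithinAt)
      (fun t ht => (hf t (interior_subset ht)).differentiableAt.differentiableWithinAt)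
      (fun t ht => ?_)
    rw [(hf t (interior_subset ht)).deriv]
    exact hf' t (interior_subset ht)
  rw [← h0]
  exact hmono ⟨le_rfl, one_pos⟩ ht ht.1

/-- The denominator lies between `(1 - t ^ 2) ^ 2` and `1`, which yields the cubic upper and lower
bounds below. -/
lemma hasDerivAt_log_ratio_defect {x t : ℝ} (hx : x ∈ Ioo (0 : ℝ) 1) (ht : t ∈ Ico (0 : ℝ) 1) :
    HasDerivAt (fun t : ℝ => x * (Real.log (1 + t) - Real.log (1 - t)) -
      (Real.log (1 + x * t) - Real.log (1 - x * t)))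
      (2 * (x * (1 - x ^ 2)) * (t ^ 2 / ((1 - t ^ 2) * (1 - (x * t) ^ 2)))) t := by
  have hxt0 : 0 ≤ x * t := mul_nonneg hx.1.le ht.1
  have hxt1 : x * t < 1 := by nlinarith [hx.1, hx.2, ht.1, ht.2]
  have h1 := (hasDerivAt_log_one_add_sub_log_one_sub (by linarith [ht.1]) ht.2).const_mul x
  have h2 := (hasDerivAt_log_one_add_sub_log_one_sub (t := x * t) (by linarith) hxt1).comp t
    ((hasDerivAt_id t).const_mul x)
  convert! h1.sub h2 using 1
  have ha : 1 - t ^ 2 ≠ 0 := by nlinarith [ht.1, ht.2]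
  have hb : 1 - x ^ 2 * t ^ 2 ≠ 0 := by rw [← mul_pow]; nlinarith
  simp only [mul_pow]
  field_simp
  ring

lemma cube_le_log_ratio_defect {x t : ℝ} (hx : x ∈ Ioo (0 : ℝ) 1) (ht : t ∈ Ico (0 : ℝ) 1) :
    2 / 3 * (x * (1 - x ^ 2)) * t ^ 3 ≤ x * (Real.log (1 + t) - Real.log (1 - t)) -
      (Real.log (1 + x * t) - Real.log (1 - x * t)) := by
  have hc : 0 < x * (1 - x ^ 2) := mul_pos hx.1 (by nlinarith [hx.1, hx.2])
  rw [← sub_nonneg]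
  refine nonneg_of_deriv_nonneg
    (f := fun t : ℝ => x * (Real.log (1 + t) - Real.log (1 - t)) -
      (Real.log (1 + x * t) - Real.log (1 - x * t)) - 2 / 3 * (x * (1 - x ^ 2)) * t ^ 3)
    (fun t ht => (hasDerivAt_log_ratio_defect hx ht).sub ((hasDerivAt_pow 3 t).const_mul _))
    (fun t ht => ?_) (by simp) ht
  have ha : 0 < 1 - t ^ 2 := by nlinarith [ht.1, ht.2]
  have hb : 0 < 1 - (x * t) ^ 2 := by
    have : (x * t) ^ 2 ≤ t ^ 2 := by
      rw [mul_pow]; exact mul_le_of_le_one_left (sq_nonneg t) (by nlinarith [hx.1, hx.2])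
    linarith
  have h1 : t ^ 2 ≤ t ^ 2 / ((1 - t ^ 2) * (1 - (x * t) ^ 2)) := by
    rw [le_div_iff₀ (mul_pos ha hb)]
    refine mul_le_of_le_one_right (sq_nonneg t) (mul_le_one₀ ?_ hb.le ?_) <;>
      nlinarith [sq_nonneg t, sq_nonneg (x * t)]
  norm_num
  nlinarith

/-- The bound `t ^ 3 / (1 - t ^ 2) ^ 2` is chosen because it telescopes exactly at `t = 1 / (2 *
s)`. -/
lemma log_ratio_defect_le {x t : ℝ} (hx : x ∈ Ioo (0 : ℝ) 1) (ht : t ∈ Ico (0 : ℝ) 1) :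
    x * (Real.log (1 + t) - Real.log (1 - t)) - (Real.log (1 + x * t) - Real.log (1 - x * t)) ≤
      2 / 3 * (x * (1 - x ^ 2)) * (t ^ 3 / (1 - t ^ 2) ^ 2) := by
  have hc : 0 < x * (1 - x ^ 2) := mul_pos hx.1 (by nlinarith [hx.1, hx.2])
  rw [← sub_nonneg]
  refine nonneg_of_deriv_nonneg
    (f := fun t : ℝ => 2 / 3 * (x * (1 - x ^ 2)) * (t ^ 3 / (1 - t ^ 2) ^ 2) -
      (x * (Real.log (1 + t) - Real.log (1 - t)) -
      (Real.log (1 + x * t) - Real.log (1 - x * t))))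
    (f' := fun t => 2 / 3 * (x * (1 - x ^ 2)) *
      (3 * t ^ 2 / (1 - t ^ 2) ^ 2 + 4 * t ^ 4 / (1 - t ^ 2) ^ 3) -
      2 * (x * (1 - x ^ 2)) * (t ^ 2 / ((1 - t ^ 2) * (1 - (x * t) ^ 2))))
    (fun t ht => ?_) (fun t ht => ?_) (by simp) ht
  · have ha : 1 - t ^ 2 ≠ 0 := by nlinarith [ht.1, ht.2]
    refine HasDerivAt.sub (HasDerivAt.const_mul _ ?_) (hasDerivAt_log_ratio_defect hx ht)
    have h := (hasDerivAt_pow 3 t).div (((hasDerivAt_pow 2 t).const_sub 1).pow 2)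
      (pow_ne_zero 2 ha)
    convert! h using 1
    norm_num
    field_simp
    ring
  · have ha : 0 < 1 - t ^ 2 := by nlinarith [ht.1, ht.2]
    have hle : 1 - t ^ 2 ≤ 1 - (x * t) ^ 2 := by
      have : (x * t) ^ 2 ≤ t ^ 2 := by
        rw [mul_pow]; exact mul_le_of_le_one_left (sq_nonneg t) (by nlinarith [hx.1, hx.2])
      linarith
    have h1 : t ^ 2 / ((1 - t ^ 2) * (1 - (x * t) ^ 2)) ≤ t ^ 2 / (1 - t ^ 2) ^ 2 := by
      rw [sq (1 - t ^ 2)]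
      gcongr
    have h2 : 0 ≤ 4 * t ^ 4 / (1 - t ^ 2) ^ 3 := by positivity
    have h3 : 3 * t ^ 2 / (1 - t ^ 2) ^ 2 = 3 * (t ^ 2 / (1 - t ^ 2) ^ 2) := by ring
    rw [h3]
    nlinarith

/-- The increment of the logarithm of `Γ(n + 1) (n + (x + 1) / 2) ^ x / Γ(n + 1 + x)`. -/
lemma log_increment_eq {x s : ℝ} (hx : x ∈ Ioo (0 : ℝ) 1) (hs : 1 / 2 < s) :
    x * (Real.log (s + 1 / 2) - Real.log (s - 1 / 2)) -
      (Real.log (s + x / 2) - Real.log (s - x / 2)) =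
    x * (Real.log (1 + 1 / (2 * s)) - Real.log (1 - 1 / (2 * s))) -
      (Real.log (1 + x * (1 / (2 * s))) - Real.log (1 - x * (1 / (2 * s)))) := by
  have hs0 : 0 < s := by linarith
  have key : ∀ y : ℝ, |y| < 2 * s → Real.log (s + y / 2) =
      Real.log s + Real.log (1 + y * (1 / (2 * s))) := by
    intro y hy
    have h1 : s + y / 2 = s * (1 + y * (1 / (2 * s))) := by field_simp
    have h2 : 0 < s + y / 2 := by have := neg_lt_of_abs_lt hy; linarith
    rw [h1] at h2 ⊢
    rw [Real.log_mul hs0.ne' (pos_of_mul_pos_right h2 hs0.le).ne']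
  have e1 := key 1 (by rw [abs_one]; linarith)
  have e2 := key (-1) (by rw [abs_neg, abs_one]; linarith)
  have e3 := key x (by rw [abs_of_pos hx.1]; linarith [hx.2])
  have e4 := key (-x) (by rw [abs_neg, abs_of_pos hx.1]; linarith [hx.2])
  rw [one_mul] at e1
  rw [show s + -1 / 2 = s - 1 / 2 by ring, show 1 + -1 * (1 / (2 * s)) = 1 - 1 / (2 * s) by ring]
    at e2
  rw [show s + -x / 2 = s - x / 2 by ring,
    show 1 + -x * (1 / (2 * s)) = 1 - x * (1 / (2 * s)) by ring] at e4
  rw [e1, e2, e3, e4]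
  ring

/-- The main term of the asymptotic bounds for `log Γ`. -/
noncomputable def logGammaApprox (x : ℝ) (n : ℕ) : ℝ :=
  x * Real.log (n + (x + 1) / 2) + Real.log n.factorial -
    ∑ m ∈ Finset.range (n + 1), Real.log (x + m)

/-- The shift `(x + 1) / 2` places the logarithms symmetrically about `s = n + 1 + x / 2`. With `t =
1 / (2 * s)`, even powers of `t` cancel, as do the linear terms, so the increment is of order `t ^
3`. -/
lemma logGammaApprox_succ_sub {x : ℝ} (hx : x ∈ Ioo (0 : ℝ) 1) (n : ℕ) :
    logGammaApprox x (n + 1) - logGammaApprox x n =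
      x * (Real.log (1 + 1 / (2 * (n + 1 + x / 2))) - Real.log (1 - 1 / (2 * (n + 1 + x / 2)))) -
      (Real.log (1 + x * (1 / (2 * (n + 1 + x / 2)))) -
        Real.log (1 - x * (1 / (2 * (n + 1 + x / 2))))) := by
  have hn : (0 : ℝ) ≤ n := n.cast_nonneg
  rw [← log_increment_eq hx (by linarith [hx.1])]
  unfold logGammaApprox
  rw [Finset.sum_range_succ _ (n + 1), Nat.factorial_succ, Nat.cast_mul,
    Real.log_mul (by positivity) (by positivity)]
  push_cast
  rw [show (n : ℝ) + 1 + (x + 1) / 2 = n + 1 + x / 2 + 1 / 2 by ring,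
    show (n : ℝ) + (x + 1) / 2 = n + 1 + x / 2 - 1 / 2 by ring,
    show x + ((n : ℝ) + 1) = n + 1 + x / 2 + x / 2 by ring,
    show (n : ℝ) + 1 + x / 2 - x / 2 = n + 1 by ring]
  ring

/-- Euler's limit for `log Γ`, perturbed by vanishing terms; `b = 0` makes the sequence decrease and
`b = 1 / 4` makes it increase. -/
lemma tendsto_logGammaApprox_add {x : ℝ} (hx : 0 < x) (b : ℝ) (hb : 0 ≤ b) :
    Tendsto (fun n : ℕ => logGammaApprox x n +
      x * (1 - x ^ 2) / 24 / ((n + (x + 1) / 2) ^ 2 + b)) atTop (𝓝 (Real.log (Real.Gamma x))) := by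
  have hn : Tendsto (fun n : ℕ => (n : ℝ)) atTop atTop := tendsto_natCast_atTop_atTop
  have h1 := Real.BohrMollerup.tendsto_log_gamma hx
  have h2 : Tendsto (fun n : ℕ => Real.log (1 + (x + 1) / 2 / n)) atTop (𝓝 0) := by
    have h3 : Tendsto (fun n : ℕ => 1 + (x + 1) / 2 / (n : ℝ)) atTop (𝓝 (1 + 0)) :=
      (tendsto_const_nhds.div_atTop hn).const_add 1
    rw [add_zero] at h3
    simpa using h3.log one_ne_zero
  have h4 : Tendsto (fun n : ℕ => x * (1 - x ^ 2) / 24 / ((n + (x + 1) / 2) ^ 2 + b)) atTop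
      (𝓝 0) := by
    refine tendsto_const_nhds.div_atTop (tendsto_atTop_mono (fun n => ?_) hn)
    have : (0 : ℝ) ≤ n := n.cast_nonneg
    rcases Nat.eq_zero_or_pos n with rfl | hpos
    · simp; positivity
    · have : (1 : ℝ) ≤ n := by exact_mod_cast hpos
      nlinarith
  have h5 := (h1.add (h2.const_mul x)).add h4
  simp only [mul_zero, add_zero] at h5
  refine h5.congr' ?_
  filter_upwards [eventually_gt_atTop 0] with n hn0
  have hn1 : (0 : ℝ) < n := by exact_mod_cast hn0
  have : Real.log (n + (x + 1) / 2) = Real.log n + Real.log (1 + (x + 1) / 2 / n) := by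
    rw [← Real.log_mul hn1.ne' (by positivity)]
    congr 1
    field_simp
  rw [logGammaApprox, this, Real.BohrMollerup.logGammaSeq]
  ring

/-- An upper bound for the logarithm of the Gamma function. -/
theorem log_Gamma_le_logGammaApprox {x : ℝ} (hx : x ∈ Ioo (0 : ℝ) 1) (n : ℕ) :
    Real.log (Real.Gamma x) ≤
      logGammaApprox x n + x * (1 - x ^ 2) / 24 / (n + (x + 1) / 2) ^ 2 := by
  have hanti : Antitone (fun n : ℕ => logGammaApprox x n +
      x * (1 - x ^ 2) / 24 / ((n + (x + 1) / 2) ^ 2 + 0)) := by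
    refine antitone_nat_of_succ_le fun n => ?_
    have hn : (0 : ℝ) ≤ n := n.cast_nonneg
    have hs : 1 < (n : ℝ) + 1 + x / 2 := by linarith [hx.1]
    have h1 := logGammaApprox_succ_sub hx n
    have h2 := log_ratio_defect_le hx (t := 1 / (2 * (n + 1 + x / 2)))
      ⟨by positivity, by rw [div_lt_one (by linarith)]; linarith⟩
    rw [← h1] at h2
    have h3 : 2 / 3 * (x * (1 - x ^ 2)) * ((1 / (2 * (n + 1 + x / 2))) ^ 3 /
        (1 - (1 / (2 * (n + 1 + x / 2))) ^ 2) ^ 2) =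
        x * (1 - x ^ 2) / 24 / ((n + (x + 1) / 2) ^ 2 + 0) -
        x * (1 - x ^ 2) / 24 / (((n + 1 : ℕ) + (x + 1) / 2) ^ 2 + 0) := by
      push_cast
      rw [show (n : ℝ) + 1 + (x + 1) / 2 = n + 1 + x / 2 + 1 / 2 by ring,
        show (n : ℝ) + (x + 1) / 2 = n + 1 + x / 2 - 1 / 2 by ring]
      generalize (n : ℝ) + 1 + x / 2 = s at hs
      have ha : 2 * s - 1 ≠ 0 := by linarith
      have hb : 2 * s + 1 ≠ 0 := by linarith
      have hs0 : s ≠ 0 := by linarith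
      have e1 : s - 1 / 2 = (2 * s - 1) / 2 := by ring
      have e2 : s + 1 / 2 = (2 * s + 1) / 2 := by ring
      have e3 : 1 - (1 / (2 * s)) ^ 2 = (2 * s - 1) * (2 * s + 1) / (4 * s ^ 2) := by
        field_simp; ring
      rw [e1, e2, e3, add_zero, add_zero]
      field_simp
      ring
    linarith
  simpa using hanti.le_of_tendsto (tendsto_logGammaApprox_add hx.1 0 le_rfl) n

/-- A lower bound for the logarithm of the Gamma function. -/
theorem logGammaApprox_le_log_Gamma {x : ℝ} (hx : x ∈ Ioo (0 : ℝ) 1) (n : ℕ) :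
    logGammaApprox x n + x * (1 - x ^ 2) / 24 / ((n + (x + 1) / 2) ^ 2 + 1 / 4) ≤
      Real.log (Real.Gamma x) := by
  have hmono : Monotone (fun n : ℕ => logGammaApprox x n +
      x * (1 - x ^ 2) / 24 / ((n + (x + 1) / 2) ^ 2 + 1 / 4)) := by
    refine monotone_nat_of_le_succ fun n => ?_
    have hn : (0 : ℝ) ≤ n := n.cast_nonneg
    have hs : 1 < (n : ℝ) + 1 + x / 2 := by linarith [hx.1]
    have h1 := logGammaApprox_succ_sub hx n
    have h2 := cube_le_log_ratio_defect hx (t := 1 / (2 * (n + 1 + x / 2)))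
      ⟨by positivity, by rw [div_lt_one (by linarith)]; linarith⟩
    rw [← h1] at h2
    -- The offset `1 / 4` makes the two denominators multiply to `s ^ 4 + 1 / 4`, so their
    -- reciprocals differ by `2 * s / (s ^ 4 + 1 / 4) ≤ 2 / s ^ 3`.
    have h3 : x * (1 - x ^ 2) / 24 / ((n + (x + 1) / 2) ^ 2 + 1 / 4) -
        x * (1 - x ^ 2) / 24 / (((n + 1 : ℕ) + (x + 1) / 2) ^ 2 + 1 / 4) ≤
        2 / 3 * (x * (1 - x ^ 2)) * (1 / (2 * (n + 1 + x / 2))) ^ 3 := by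
      push_cast
      rw [show (n : ℝ) + 1 + (x + 1) / 2 = n + 1 + x / 2 + 1 / 2 by ring,
        show (n : ℝ) + (x + 1) / 2 = n + 1 + x / 2 - 1 / 2 by ring]
      generalize (n : ℝ) + 1 + x / 2 = s at hs
      have hs0 : 0 < s := by linarith
      have hc : 0 < x * (1 - x ^ 2) := mul_pos hx.1 (by nlinarith [hx.1, hx.2])
      have e : x * (1 - x ^ 2) / 24 / ((s - 1 / 2) ^ 2 + 1 / 4) -
          x * (1 - x ^ 2) / 24 / ((s + 1 / 2) ^ 2 + 1 / 4) =
          x * (1 - x ^ 2) / 24 * (2 * s / (s ^ 4 + 1 / 4)) := by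
        have ha : (s - 1 / 2) ^ 2 + 1 / 4 ≠ 0 := by positivity
        have hb : (s + 1 / 2) ^ 2 + 1 / 4 ≠ 0 := by positivity
        have hd : s ^ 4 + 1 / 4 ≠ 0 := by positivity
        have hprod : s ^ 4 + 1 / 4 = ((s - 1 / 2) ^ 2 + 1 / 4) * ((s + 1 / 2) ^ 2 + 1 / 4) := by
          ring
        rw [hprod, div_sub_div _ _ ha hb, ← mul_div_assoc]
        ring
      rw [e]
      have h4 : 2 * s / (s ^ 4 + 1 / 4) ≤ 2 / s ^ 3 := by
        rw [div_le_div_iff₀ (by positivity) (by positivity)]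
        nlinarith
      calc x * (1 - x ^ 2) / 24 * (2 * s / (s ^ 4 + 1 / 4))
          ≤ x * (1 - x ^ 2) / 24 * (2 / s ^ 3) := by gcongr
        _ = 2 / 3 * (x * (1 - x ^ 2)) * (1 / (2 * s)) ^ 3 := by
          field_simp
          ring
    linarith
  exact hmono.ge_of_tendsto (tendsto_logGammaApprox_add hx.1 (1 / 4) (by norm_num)) n

/-! ### Numerical estimates -/

/-- Uses `log ((1 + t) / (1 - t)) = 2 artanh t`; in applications `t` is `(q - 1) / (q + 1)` rounded
down, or up for the companion upper bound. -/
lemma le_log_of_artanh_sum {t q b : ℝ} (n : ℕ) (h0 : 0 ≤ t) (h1 : t < 1)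
    (hq : (1 + t) / (1 - t) ≤ q)
    (hb : b ≤ 2 * ∑ i ∈ Finset.range n, t ^ (2 * i + 1) / (2 * i + 1)) : b ≤ Real.log q := by
  have h2 := Real.sum_range_le_log_div h0 h1 n
  have h3 : 0 < (1 + t) / (1 - t) := div_pos (by linarith) (by linarith)
  have h4 := Real.log_le_log h3 hq
  linarith

lemma log_le_of_artanh_sum {t q b : ℝ} (n : ℕ) (h0 : 0 ≤ t) (h1 : t < 1) (hq0 : 0 < q)
    (hq : q ≤ (1 + t) / (1 - t))
    (hb : 2 * (∑ i ∈ Finset.range n, t ^ (2 * i + 1) / (2 * i + 1) +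
      t ^ (2 * n + 1) / (1 - t ^ 2)) ≤ b) : Real.log q ≤ b := by
  have h2 := Real.log_div_le_sum_range_add h0 h1 n
  have h4 := Real.log_le_log hq0 hq
  linarith

lemma le_log_four_div_pi : 0.241564475 ≤ Real.log (4 / Real.pi) := by
  refine le_log_of_artanh_sum (t := 0.120198307) 5 (by norm_num) (by norm_num) ?_ ?_
  · rw [le_div_iff₀ Real.pi_pos]
    refine (mul_le_mul_of_nonneg_left Real.pi_lt_d20.le (by norm_num)).trans ?_
    norm_num
  · norm_num [Finset.sum_range_succ]

lemma log_four_div_pi_le : Real.log (4 / Real.pi) ≤ 0.241564476 := by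
  refine log_le_of_artanh_sum (t := 0.1201983071) 5 (by norm_num) (by norm_num)
    (div_pos (by norm_num) Real.pi_pos) ?_ ?_
  · rw [div_le_iff₀ Real.pi_pos]
    refine le_trans ?_ (mul_le_mul_of_nonneg_left Real.pi_gt_d20.le (by norm_num))
    norm_num
  · norm_num [Finset.sum_range_succ]

lemma log_Gamma_add_two {x : ℝ} (hx : 0 < x) :
    Real.log (Real.Gamma (x + 2)) =
      Real.log x + Real.log (x + 1) + Real.log (Real.Gamma x) := by
  have h1 : Real.Gamma (x + 2) = (x + 1) * (x * Real.Gamma x) := by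
    rw [show x + 2 = x + 1 + 1 by ring, Real.Gamma_add_one (by linarith),
      Real.Gamma_add_one hx.ne']
  have hG := Real.Gamma_pos_of_pos hx
  rw [h1, Real.log_mul (by linarith) (by positivity), Real.log_mul hx.ne' hG.ne']
  ring

/-- Powers of two are factored out so that, for the `x` used below, the remaining logarithms have
arguments near `1`, where the artanh series converges fast. -/
lemma logGammaApprox_fifteen {x : ℝ} (hx : 0 < x) :
    Real.log x + Real.log (x + 1) + logGammaApprox x 15 =
      x * (4 * Real.log 2 - Real.log (16 / (15 + (x + 1) / 2))) - 2 * Real.log 2 -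
        Real.log ((∏ m ∈ Finset.range 14, (x + (m + 2))) / (4 * Nat.factorial 15)) := by
  have hprod : 0 < ∏ m ∈ Finset.range 14, (x + ((m : ℝ) + 2)) :=
    Finset.prod_pos fun m _ => by positivity
  have h4 : Real.log 4 = 2 * Real.log 2 := by
    rw [show (4 : ℝ) = 2 ^ 2 by norm_num, Real.log_pow]; norm_num
  have h16 : Real.log 16 = 4 * Real.log 2 := by
    rw [show (16 : ℝ) = 2 ^ 4 by norm_num, Real.log_pow]; norm_num
  rw [Real.log_div (by norm_num) (by positivity), h16, Real.log_div hprod.ne' (by positivity),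
    Real.log_mul (by norm_num) (by positivity), h4, Real.log_prod fun m _ => by positivity,
    logGammaApprox, Finset.sum_range_succ', Finset.sum_range_succ']
  push_cast
  simp only [add_assoc, one_add_one_eq_two]
  norm_num
  ring

/-- Here `0.6556875 + 2 = 1 + p / 2` for `p = 3.311375`, the left end of the rounding interval. At
`n = 15` the upper and lower bounds for `log Γ` differ by less than `10⁻⁷`. -/
lemma log_Gamma_lt_at_left :
    Real.log (Real.Gamma (0.6556875 + 2)) < (1 + 0.6556875) * Real.log (4 / Real.pi) := by
  have hU := log_Gamma_le_logGammaApprox (x := 0.6556875) ⟨by norm_num, by norm_num⟩ 15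
  have hA := logGammaApprox_fifteen (x := 0.6556875) (by norm_num)
  have h1 : 0.0108180705 ≤ Real.log (16 / (15 + ((0.6556875 : ℝ) + 1) / 2)) :=
    le_log_of_artanh_sum (t := 0.0054089825) 3 (by norm_num) (by norm_num) (by norm_num)
      (by norm_num [Finset.sum_range_succ])
  have h2 : 0.0246712098 ≤ Real.log
      ((∏ m ∈ Finset.range 14, ((0.6556875 : ℝ) + (m + 2))) / (4 * Nat.factorial 15)) :=
    le_log_of_artanh_sum (t := 0.0123349793) 3 (by norm_num) (by norm_num)
      (by norm_num [Finset.prod_range_succ, Nat.factorial]) (by norm_num [Finset.sum_range_succ])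
  have h3 := le_log_four_div_pi
  have h4 := Real.log_two_lt_d9
  rw [log_Gamma_add_two (by norm_num)]
  have hc : (0.6556875 : ℝ) * (1 - 0.6556875 ^ 2) / 24 / ((15 : ℕ) + (0.6556875 + 1) / 2) ^ 2 ≤
      0.000062169 := by norm_num
  linarith

lemma lt_log_Gamma_at_right :
    (1 + 0.6556925) * Real.log (4 / Real.pi) < Real.log (Real.Gamma (0.6556925 + 2)) := by
  have hL := logGammaApprox_le_log_Gamma (x := 0.6556925) ⟨by norm_num, by norm_num⟩ 15
  have hA := logGammaApprox_fifteen (x := 0.6556925) (by norm_num)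
  have h1 : Real.log (16 / (15 + ((0.6556925 : ℝ) + 1) / 2)) ≤ 0.0108179127 :=
    log_le_of_artanh_sum (t := 0.0054089036) 3 (by norm_num) (by norm_num) (by norm_num)
      (by norm_num) (by norm_num [Finset.sum_range_succ])
  have h2 : Real.log
      ((∏ m ∈ Finset.range 14, ((0.6556925 : ℝ) + (m + 2))) / (4 * Nat.factorial 15)) ≤
        0.0246812386 :=
    log_le_of_artanh_sum (t := 0.0123399928) 3 (by norm_num) (by norm_num)
      (div_pos (Finset.prod_pos fun m _ => by positivity) (by positivity))
      (by norm_num [Finset.prod_range_succ, Nat.factorial]) (by norm_num [Finset.sum_range_succ])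
  have h3 := log_four_div_pi_le
  have h4 := Real.log_two_gt_d9
  rw [log_Gamma_add_two (by norm_num)]
  have hc : 0.000062106 ≤ (0.6556925 : ℝ) * (1 - 0.6556925 ^ 2) / 24 /
      (((15 : ℕ) + (0.6556925 + 1) / 2) ^ 2 + 1 / 4) := by norm_num
  linarith

/-! ### The equation for the critical exponent -/

lemma log_four_div_pi_pos : 0 < Real.log (4 / Real.pi) :=
  lt_of_lt_of_le (by norm_num) le_log_four_div_pi

/-- By log-convexity, `log Γ(1 + y)` crosses an increasing line through the origin at most once,
from below. -/
lemma lt_log_Gamma_of_eq {a b κ : ℝ} (ha : 0 < a) (hab : a < b) (hκ : 0 < κ)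
    (h : Real.log (Real.Gamma (1 + a)) = κ * a) :
    κ * b < Real.log (Real.Gamma (1 + b)) := by
  have hconv := Real.convexOn_log_Gamma
  have h1 : Real.log (Real.Gamma (1 + 1)) = 0 := by
    rw [one_add_one_eq_two, Real.Gamma_two, Real.log_one]
  -- Convexity and `Γ(1) = Γ(2) = 1` give `log Γ ≤ 0` on `[1, 2]`, so no crossing with a positive
  -- value occurs there.
  have ha1 : 1 < a := by
    by_contra! hle
    have := hconv.2 (show (1 : ℝ) ∈ Ioi 0 by simp) (show (1 + 1 : ℝ) ∈ Ioi 0 by simp)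
      (show 0 ≤ 1 - a by linarith) ha.le (by ring)
    simp only [Function.comp, smul_eq_mul, h1, Real.Gamma_one, Real.log_one, mul_zero,
      add_zero] at this
    rw [show (1 - a) * 1 + a * (1 + 1) = 1 + a by ring, h] at this
    exact absurd this (not_le.mpr (mul_pos hκ ha))
  -- Otherwise the chord of `log Γ` from `2` to `1 + b` bounds the value at `1 + a` by `(a - 1) / (b
  -- - 1) * (κ * b) < κ * a`.
  by_contra! hle
  have hb1 : 0 < b - 1 := by linarith
  have := hconv.2 (show (1 + 1 : ℝ) ∈ Ioi 0 by simp)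
    (show 1 + b ∈ Ioi 0 by rw [mem_Ioi]; linarith)
    (show 0 ≤ (b - a) / (b - 1) from div_nonneg (by linarith) hb1.le)
    (show 0 ≤ (a - 1) / (b - 1) from div_nonneg (by linarith) hb1.le) (by field_simp; ring)
  simp only [Function.comp, smul_eq_mul, h1, mul_zero, zero_add] at this
  rw [show (b - a) / (b - 1) * (1 + 1) + (a - 1) / (b - 1) * (1 + b) = 1 + a by
    field_simp; ring, h] at this
  have h2 : (a - 1) / (b - 1) * Real.log (Real.Gamma (1 + b)) ≤ (a - 1) / (b - 1) * (κ * b) :=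
    mul_le_mul_of_nonneg_left hle (div_nonneg (by linarith) hb1.le)
  have h3 : (a - 1) / (b - 1) * (κ * b) < κ * a := by
    rw [div_mul_eq_mul_div, div_lt_iff₀ hb1]
    nlinarith
  linarith

lemma log_two_div_sqrt_pi : Real.log (2 / √Real.pi) = Real.log (4 / Real.pi) / 2 := by
  have h : 4 / Real.pi = (2 / √Real.pi) ^ 2 := by
    rw [div_pow, Real.sq_sqrt Real.pi_pos.le]; norm_num
  rw [h, Real.log_pow]
  push_cast
  ring

lemma Gamma_rpow_eq_iff {p : ℝ} (hp : 0 < p) :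
    Real.Gamma (1 + p / 2) ^ (1 / p) = 2 / √Real.pi ↔
      Real.log (Real.Gamma (1 + p / 2)) = Real.log (4 / Real.pi) * (p / 2) := by
  have hG : 0 < Real.Gamma (1 + p / 2) := Real.Gamma_pos_of_pos (by linarith)
  have hpi := Real.pi_pos
  rw [← (Real.log_injOn_pos.eq_iff (x := Real.Gamma (1 + p / 2) ^ (1 / p)) (y := 2 / √Real.pi)
    (Real.rpow_pos_of_pos hG _) (by simp; positivity)), Real.log_rpow hG, log_two_div_sqrt_pi]
  constructor
  · intro h
    rw [div_mul_eq_mul_div, one_mul, div_eq_iff hp.ne'] at h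
    rw [h]
    ring
  · intro h
    rw [h]
    field_simp

lemma RieszBounded.log_Gamma_le {p : ℝ} (hp : 0 < p) (hb : RieszBounded ∞ (ENNReal.ofReal p)) :
    Real.log (Real.Gamma (1 + p / 2)) ≤ Real.log (4 / Real.pi) * (p / 2) := by
  have h := hb.Gamma_rpow_le hp
  have hpi := Real.pi_pos
  have hG : 0 < Real.Gamma (1 + p / 2) := Real.Gamma_pos_of_pos (by linarith)
  have h32 : Real.Gamma (3 / 2) = √Real.pi / 2 := by
    rw [show (3 / 2 : ℝ) = 1 / 2 + 1 by norm_num, Real.Gamma_add_one (by norm_num),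
      Real.Gamma_one_half_eq]
    ring
  have h2 : Real.Gamma (1 + p / 2) ^ (1 / p) ≤ 2 / √Real.pi := by
    rw [h32] at h
    rw [le_div_iff₀ (by positivity)]
    linarith
  have h3 := Real.log_le_log (Real.rpow_pos_of_pos hG _) h2
  rw [Real.log_rpow hG, log_two_div_sqrt_pi] at h3
  have h4 := mul_le_mul_of_nonneg_left h3 hp.le
  rw [← mul_assoc, mul_one_div_cancel hp.ne', one_mul] at h4
  linarith

lemma exists_log_Gamma_eq : ∃ p : ℝ, p ∈ Icc (3.311375 : ℝ) 3.311385 ∧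
    Real.log (Real.Gamma (1 + p / 2)) = Real.log (4 / Real.pi) * (p / 2) := by
  have hcont : ContinuousOn (fun p : ℝ => Real.log (Real.Gamma (1 + p / 2)) -
      Real.log (4 / Real.pi) * (p / 2)) (Icc 3.311375 3.311385) := by
    intro p hp
    have hp0 : 0 < 1 + p / 2 := by have := hp.1; norm_num at this; linarith
    refine ContinuousAt.continuousWithinAt (ContinuousAt.sub (ContinuousAt.log ?_
      (Real.Gamma_pos_of_pos hp0).ne') (by fun_prop))
    have hd : DifferentiableAt ℝ Real.Gamma (1 + p / 2) :=
      Real.differentiableAt_Gamma fun m => by have : (0 : ℝ) ≤ m := m.cast_nonneg; linarith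
    exact hd.continuousAt.comp (f := fun p : ℝ => 1 + p / 2)
      (by fun_prop)
  have hl := log_Gamma_lt_at_left
  have hr := lt_log_Gamma_at_right
  obtain ⟨p, hp, h⟩ := intermediate_value_Icc (by norm_num) hcont
    (show (0 : ℝ) ∈ _ by
      constructor
      · rw [show (1 : ℝ) + 3.311375 / 2 = 0.6556875 + 2 by norm_num]
        norm_num at hl ⊢
        linarith
      · rw [show (1 : ℝ) + 3.311385 / 2 = 0.6556925 + 2 by norm_num]
        norm_num at hr ⊢
        linarith)
  exact ⟨p, hp, sub_eq_zero.mp h⟩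

lemma criticalExponent_le_ofReal {p₀ : ℝ} (hp₀ : 2 ≤ p₀)
    (h : Real.log (Real.Gamma (1 + p₀ / 2)) = Real.log (4 / Real.pi) * (p₀ / 2)) :
    criticalExponent ≤ ENNReal.ofReal p₀ := by
  refine sSup_le fun p hp => ?_
  by_contra! hlt
  -- Passing to a real exponent below `p` also covers `p = ∞`.
  obtain ⟨q, hq0, hq, hqp⟩ := ENNReal.lt_iff_exists_real_btwn.mp hlt
  have hq' : p₀ < q := (ENNReal.ofReal_lt_ofReal_iff_of_nonneg (by linarith)).mp hq
  have h1 := (hp.2.mono hqp.le).log_Gamma_le (by linarith)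
  have h2 := lt_log_Gamma_of_eq (a := p₀ / 2) (b := q / 2) (by linarith) (by linarith)
    log_four_div_pi_pos h
  linarith

end PolytorusRiesz

/-! ### The main theorem -/

theorem theorem1 :
    ∃ p₀ : ℝ,
      (∀ p : ℝ, (0 < p ∧ Real.Gamma (1 + p / 2) ^ (1 / p) = 2 / Real.sqrt Real.pi) ↔ p = p₀) ∧
      |p₀ - 3.31138| ≤ 0.000005 ∧
      IsGreatest PolytorusRiesz.boundedExponents PolytorusRiesz.criticalExponent ∧
      PolytorusRiesz.criticalExponent ≤ ENNReal.ofReal p₀ := by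
  obtain ⟨p₀, ⟨hlo, hhi⟩, h⟩ := PolytorusRiesz.exists_log_Gamma_eq
  norm_num at hlo hhi
  have hp₀ : 2 ≤ p₀ := by linarith
  have hle := PolytorusRiesz.criticalExponent_le_ofReal hp₀ h
  refine ⟨p₀, fun p => ⟨fun ⟨hp, heq⟩ => ?_, ?_⟩, ?_, ?_, hle⟩
  · rw [PolytorusRiesz.Gamma_rpow_eq_iff hp] at heq
    rcases lt_trichotomy p p₀ with hlt | rfl | hlt
    · have := PolytorusRiesz.lt_log_Gamma_of_eq (a := p / 2) (b := p₀ / 2) (by linarith)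
        (by linarith) PolytorusRiesz.log_four_div_pi_pos heq
      linarith
    · rfl
    · have := PolytorusRiesz.lt_log_Gamma_of_eq (a := p₀ / 2) (b := p / 2) (by linarith)
        (by linarith) PolytorusRiesz.log_four_div_pi_pos h
      linarith
  · rintro rfl
    have hp : 0 < p := by linarith
    exact ⟨hp, (PolytorusRiesz.Gamma_rpow_eq_iff hp).mpr h⟩
  · rw [abs_le]
    norm_num
    constructor <;> linarith
  -- The upper bound supplies the finiteness on which attainment rests.
  · exact PolytorusRiesz.isGreatest_criticalExponent (hle.trans_lt ENNReal.ofReal_lt_top).ne
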